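/- **Conventions.** A left skew brace is a set $E$ with two group structures $(E,+)$, $(E,\circ)$ such that $a\circ(b+c)=a\circ b-a+a\circ c$; it is trivial if $a\circ b=a+b$ (the group need not be commutative). $\operatorname{Autb}$ denotes the group of skew brace automorphisms. Let $H$ be a left skew brace, $I$ a trivial skew brace with centre $\operatorname{Z}(I)$. An extension $\mathcal E:0\to I\xrightarrow{i}E\xrightarrow{\pi}H\to0$ is a short exact sequence of skew braces; equivalence of extensions is an isomorphism of the middle terms inducing the identity on $I$ and $H$. A section is a map $s:H\to E$ with $\pi s=\mathrm{id}$, $s(0)=0$; it gives the triple $\chi_s=(\nu,\mu,\sigma)$ of families of automorphisms of $I$, $$\nu_h(y)=-s(h)+s(h)\circ y,\quad \mu_h(y)=-s(h)+y+s(h),\quad \sigma_h(y)=s(h)^{-1}\circ y\circ s(h).$$ Two triples $(\nu',\mu',\sigma')$, $(\nu,\mu,\sigma)$ define the same coupling, written $\approx$, if there is one map $t:H\to I$ with $t(0)=0$ such that for all $h$: $\nu'_h=\nu_h$, $\mu'_h$ is $\mu_h$ followed by conjugation $z\mapsto a+z-a$ with $a=\nu_h(-t(h))$, and $\sigma'_h$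 is $\sigma_h$ followed by $z\mapsto t(h)^{-1}\circ z\circ t(h)$. The coupling of $\mathcal E$ is the $\approx$-class of $\chi_s$ (independent of $s$). Fix a triple $\chi=(\nu,\mu,\sigma)$ and let $(\nu,\bar\mu,\bar\sigma)$ be its coupling; $\operatorname{Ext}_{(\nu,\bar\mu,\bar\sigma)}(H,I)$ is the set of classes of extensions with this coupling. For $c=(\phi,\theta)\in\operatorname{Autb}(H)\times\operatorname{Autb}(I)$ let $\mathcal E^{c}$ be the extension $0\to I\xrightarrow{i\theta}E\xrightarrow{\phi^{-1}\pi}H\to0$, and let $$\operatorname{C}_{(\nu,\bar\mu,\bar\sigma)}=\{(\phi,\theta):(\theta^{-1}\nu_{\phi(h)}\theta,\ \theta^{-1}\mu_{\phi(h)}\theta,\ \theta^{-1}\sigma_{\phi(h)}\theta)_{h}\approx(\nu,\mu,\sigma)\}$$ be the stabiliser of the coupling. Let $\operatorname{Autb}_I(E)=\{\gamma\in\operatorname{Autb}(E):\gamma(I)=I\}$. $\operatorname{Z}^1_N(H,\operatorname{Z}(I))$ is the group of maps $l:H\to \operatorname{Z}(I)$ with $l(h_1\circ h_2)=\sigma_{h_2}(l(h_1))+l(h_2)$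 and $\nu_{h_1+h_2}(l(h_1+h_2))=\mu_{h_2}(\nu_{h_1}(l(h_1)))+\nu_{h_2}(l(h_2))$. $\operatorname{Z}^2_N(H,\operatorname{Z}(I))$ is the group of pairs $(g,f)$ of maps $H\times H\to \operatorname{Z}(I)$ that vanish when an argument is $0$ and satisfy $$g(h_1,h_2+h_3)+g(h_2,h_3)-g(h_1+h_2,h_3)-\mu_{h_3}(g(h_1,h_2))=0,$$ $$f(h_1,h_2\circ h_3)+f(h_2,h_3)-f(h_1\circ h_2,h_3)-\sigma_{h_3}(f(h_1,h_2))=0,$$ $$\nu_{h_1\circ(h_2+h_3)}(f(h_1,h_2+h_3))+\nu_{h_1}(g(h_2,h_3))=g(h_1\circ h_2-h_1,h_1\circ h_3)+\mu_{h_1\circ h_3}\big(g(h_1\circ h_2,-h_1)+\mu_{-h_1}(\nu_{h_1\circ h_2}(f(h_1,h_2)))-g(h_1,-h_1)\big)+\nu_{h_1\circ h_3}(f(h_1,h_3)).$$ $\operatorname{B}^2_N$ is the subgroup of those $(g,f)\in\operatorname{Z}^2_N$ for which there is $t:H\to \operatorname{Z}(I)$ with $g(h_1,h_2)=\nu_{h_1+h_2}(-t(h_1+h_2))+\mu_{h_2}(\nu_{h_1}(t(h_1)))+\nu_{h_2}(t(h_2))$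 and $f(h_1,h_2)=-t(h_1\circ h_2)+\sigma_{h_2}(t(h_1))+t(h_2)$, and $\operatorname{H}^2_N=\operatorname{Z}^2_N/\operatorname{B}^2_N$. The group $\operatorname{C}_{(\nu,\bar\mu,\bar\sigma)}$ acts on $\operatorname{H}^2_N(H,\operatorname{Z}(I))$ from the right by $[(g,f)]^{(\phi,\theta)}=[(\theta^{-1}g(\phi\cdot,\phi\cdot),\theta^{-1}f(\phi\cdot,\phi\cdot))]$. For $\mathcal E$ with the given coupling and $(g,f)\in \operatorname{Z}^2_N$, let $\mathcal E^{(g,f)}$ be the extension with the same set $E$ and maps $i,\pi$, and operations $x+'y=x+y+g(\pi x,\pi y)$, $x\circ'y=x\circ y\circ f(\pi x,\pi y)$ (this adds $(g,f)$ to the pair $(-s(h_1+h_2)+s(h_1)+s(h_2),\ s(h_1\circ h_2)^{-1}\circ s(h_1)\circ s(h_2))$ of a section $s$, without changing its triple). **Theorem (Wells-like exact sequence).** Let $\mathcal E:0\to I\to E\to H\to 0$ be an extension of a left skew brace $H$ by a trivial skew brace $I$ with $[\mathcal E]\in\operatorname{Ext}_{(\nu,\bar\mu,\bar\sigma)}(H,I)$.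 There is an exact sequence $$0\to\operatorname{Z}^1_N(H,\operatorname{Z}(I))\xrightarrow{\ \psi\ }\operatorname{Autb}_I(E)\xrightarrow{\rho(\mathcal E)}\operatorname{C}_{(\nu,\bar\mu,\bar\sigma)}\xrightarrow{\omega(\mathcal E)}\operatorname{H}^2_N(H,\operatorname{Z}(I)),$$ where $\psi(l)(x)=x\circ l(\pi(x))$; $\rho(\mathcal E)(\gamma)=(\gamma_H,\gamma_I)$ consists of the automorphisms induced by $\gamma$ on $H$ and $I$; and $\omega(\mathcal E)(c)$ is the unique class $k$ such that, for all $(g,f)\in\operatorname{Z}^2_N$, $\mathcal E^{c}$ is equivalent to $\mathcal E^{(g,f)}$ if and only if $(g,f)$ represents $k$. The maps $\psi$ and $\rho(\mathcal E)$ are group homomorphisms, $\psi$ is injective, $\operatorname{Im}\psi=\operatorname{Ker}\rho(\mathcal E)$ and $\operatorname{Im}\rho(\mathcal E)=\{c:\omega(\mathcal E)(c)=0\}$. The map $\omega(\mathcal E)$ is a derivation, $\omega(\mathcal E)(cd)=\omega(\mathcal E)(c)^{d}+\omega(\mathcal E)(d)$; it is in general not a homomorphism: there are $H$, $I$, $\mathcal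 E$ as above for which it is not one. -/

import Mathlib

universe u v w

/-- A left skew brace: two group structures `(E, +)` (not necessarily commutative) and `(E, ∘)`,
the latter written multiplicatively, with `a ∘ (b + c) = a ∘ b - a + a ∘ c`. -/
class SkewBrace (E : Type*) extends AddGroup E, Group E where
  mul_add_brace : ∀ a b c : E, a * (b + c) = a * b - a + a * c

namespace SkewBrace

/-- A trivial skew brace: the two operations coincide (and need not be commutative). -/
class IsTrivial (I : Type*) [SkewBrace I] : Prop where
  mul_eq_add : ∀ a b : I, a * b = a + b

/-- The map `λ_a(b) = -a + a ∘ b`. -/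
def lam {E : Type*} [SkewBrace E] (a b : E) : E := -a + a * b

section Basic

variable {E : Type*} [SkewBrace E]

theorem one_eq_zero : (1 : E) = 0 := by
  have h := mul_add_brace (1 : E) 0 0
  rw [one_mul, one_mul, add_zero, zero_sub, add_zero] at h
  exact neg_eq_zero.mp h.symm

theorem mul_zero' (a : E) : a * 0 = a := by rw [← one_eq_zero, mul_one]

theorem zero_mul' (a : E) : 0 * a = a := by rw [← one_eq_zero, one_mul]

theorem mul_eq (a b : E) : a * b = a + lam a b := by rw [lam, add_neg_cancel_left]

theorem lam_add (a b c : E) : lam a (b + c) = lam a b + lam a c := by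
  simp only [lam, mul_add_brace, sub_eq_add_neg, add_assoc]

theorem lam_zero (a : E) : lam a 0 = 0 := by rw [lam, mul_zero', neg_add_cancel]

theorem zero_lam (b : E) : lam 0 b = b := by rw [lam, zero_mul', neg_zero, zero_add]

theorem lam_neg (a b : E) : lam a (-b) = -lam a b := by
  apply eq_neg_of_add_eq_zero_left
  rw [← lam_add, neg_add_cancel, lam_zero]

theorem lam_mul (a b c : E) : lam (a * b) c = lam a (lam b c) := by
  have h : lam a (b * c) = lam a b + lam a (lam b c) := by rw [← lam_add, ← mul_eq]
  have h2 : lam a (lam b c) = -lam a b + lam a (b * c) := by rw [h, neg_add_cancel_left]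
  rw [h2]
  simp only [lam, neg_add_rev, neg_neg, mul_assoc, add_assoc, add_neg_cancel_left]

theorem map_lam {F : Type*} [SkewBrace F] (e : E ≃+* F) (a b : E) :
    e (lam a b) = lam (e a) (e b) := by
  have h : e (a * b) = e a + e (lam a b) := by rw [mul_eq a b, map_add]
  change _ = -e a + e a * e b
  rw [← map_mul, h, neg_add_cancel_left]

theorem aut_zero {F : Type*} [SkewBrace F] (e : E ≃+* F) : e 0 = 0 :=
  map_zero e.toAddEquiv

theorem aut_neg {F : Type*} [SkewBrace F] (e : E ≃+* F) (a : E) : e (-a) = -e a :=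
  map_neg e.toAddEquiv a

theorem aut_inv {F : Type*} [SkewBrace F] (e : E ≃+* F) (a : E) : e a⁻¹ = (e a)⁻¹ :=
  map_inv e.toMulEquiv a

end Basic

instance centerAddCommGroup (I : Type*) [SkewBrace I] : AddCommGroup (AddSubgroup.center I) :=
  { (inferInstance : AddGroup (AddSubgroup.center I)) with
    add_comm := fun a b => Subtype.ext (AddSubgroup.mem_center_iff.mp b.2 a) }

/-- Triples `χ = (ν, μ, σ)` of maps `ν, μ : H → Aut (I, +)`, `σ : H → Aut (I, ∘)`. -/
@[ext]
structure Triple (H : Type u) (I : Type v) [SkewBrace I] where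
  nu : H → (I ≃+ I)
  mu : H → (I ≃+ I)
  sigma : H → (I ≃* I)

variable {H : Type u} {I : Type v} [SkewBrace H] [SkewBrace I]

namespace Triple

/-- `χ'.Approx χ`: the two triples define the same coupling, i.e. there is *one* map `t : H → I`
with `t 0 = 0`, `ν'_h = ν_h λ_{t h}`, `μ'_h = i⁺_{ν_h(- t h)} μ_h`, `σ'_h = i^∘_{(t h)⁻¹} σ_h`,
where `i⁺_a(z) = a + z - a` and `i^∘_a(z) = a ∘ z ∘ a⁻¹`. -/
def Approx (χ' χ : Triple H I) : Prop :=
  ∃ t : H → I, t 0 = 0 ∧ ∀ h y,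
    χ'.nu h y = χ.nu h (lam (t h) y) ∧
    χ'.mu h y = χ.nu h (-t h) + χ.mu h y - χ.nu h (-t h) ∧
    χ'.sigma h y = (t h)⁻¹ * χ.sigma h y * t h

theorem Approx.refl (χ : Triple H I) : Approx χ χ :=
  ⟨fun _ => 0, rfl, fun h y => by
    refine ⟨by rw [zero_lam], by simp, ?_⟩
    rw [← one_eq_zero]; simp⟩

theorem Approx.trans {χ₃ χ₂ χ₁ : Triple H I} (h₁ : Approx χ₃ χ₂) (h₂ : Approx χ₂ χ₁) :
    Approx χ₃ χ₁ := by
  obtain ⟨t, ht, hst⟩ := h₁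
  obtain ⟨r, hr, hsr⟩ := h₂
  refine ⟨fun h => r h * t h, by simp only [ht, hr, zero_mul'], fun h y => ⟨?_, ?_, ?_⟩⟩
  · rw [(hst h y).1, (hsr h _).1, lam_mul]
  · have e : χ₁.nu h (-(r h * t h)) = χ₂.nu h (-t h) + χ₁.nu h (-r h) := by
      rw [(hsr h _).1, ← map_add, lam_neg, ← neg_add_rev, ← mul_eq]
    rw [(hst h y).2.1, (hsr h _).2.1, e]
    simp only [sub_eq_add_neg, neg_add_rev, add_assoc]
  · rw [(hst h y).2.2, (hsr h _).2.2]
    simp only [mul_inv_rev, mul_assoc]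

theorem Approx.symm {χ' χ : Triple H I} (h : Approx χ' χ) : Approx χ χ' := by
  obtain ⟨t, ht, hst⟩ := h
  have e0 : ∀ h, lam (t h) (t h)⁻¹ = -t h := fun h => by
    rw [lam, mul_inv_cancel, one_eq_zero, add_zero]
  have e : ∀ h, χ'.nu h (-(t h)⁻¹) = -χ.nu h (-t h) := fun h => by
    rw [(hst h _).1, lam_neg, e0, map_neg]
  refine ⟨fun h => (t h)⁻¹, by simp only [ht]; rw [← one_eq_zero, inv_one],
    fun h y => ⟨?_, ?_, ?_⟩⟩
  · rw [(hst h _).1, ← lam_mul, mul_inv_cancel, one_eq_zero, zero_lam]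
  · rw [e, (hst h y).2.1]
    simp only [sub_eq_add_neg, neg_neg, add_assoc, neg_add_cancel_left, neg_add_cancel, add_zero]
  · rw [(hst h y).2.2]
    simp only [inv_inv, mul_assoc, mul_inv_cancel_left, mul_inv_cancel, mul_one]

/-- For `c = (φ, θ)`: the triple `h ↦ (θ⁻¹ ν_{φ h} θ, θ⁻¹ μ_{φ h} θ, θ⁻¹ σ_{φ h} θ)`. -/
def pull (χ : Triple H I) (c : RingAut H × RingAut I) : Triple H I where
  nu h := (c.2.toAddEquiv.trans (χ.nu (c.1 h))).trans c.2.toAddEquiv.symm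
  mu h := (c.2.toAddEquiv.trans (χ.mu (c.1 h))).trans c.2.toAddEquiv.symm
  sigma h := (c.2.toMulEquiv.trans (χ.sigma (c.1 h))).trans c.2.toMulEquiv.symm

theorem pull_nu (χ : Triple H I) (c : RingAut H × RingAut I) (h : H) (y : I) :
    (χ.pull c).nu h y = c.2.symm (χ.nu (c.1 h) (c.2 y)) := rfl

theorem pull_mu (χ : Triple H I) (c : RingAut H × RingAut I) (h : H) (y : I) :
    (χ.pull c).mu h y = c.2.symm (χ.mu (c.1 h) (c.2 y)) := rfl

theorem pull_sigma (χ : Triple H I) (c : RingAut H × RingAut I) (h : H) (y : I) :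
    (χ.pull c).sigma h y = c.2.symm (χ.sigma (c.1 h) (c.2 y)) := rfl

theorem pull_one (χ : Triple H I) : χ.pull 1 = χ := rfl

theorem pull_mul (χ : Triple H I) (c d : RingAut H × RingAut I) :
    χ.pull (c * d) = (χ.pull c).pull d := rfl

theorem Approx.pull {χ' χ : Triple H I} (h : Approx χ' χ) (c : RingAut H × RingAut I) :
    Approx (χ'.pull c) (χ.pull c) := by
  obtain ⟨t, ht, hst⟩ := h
  have ec : ∀ x, c.2 (c.2.symm x) = x := c.2.apply_symm_apply
  refine ⟨fun h => c.2.symm (t (c.1 h)), by simp only [aut_zero, ht], fun h y => ⟨?_, ?_, ?_⟩⟩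
  · simp only [pull_nu, (hst _ _).1, map_lam c.2, ec]
  · simp only [pull_nu, pull_mu, (hst _ _).2.1, aut_neg c.2, ec, sub_eq_add_neg,
      map_add c.2.symm, aut_neg c.2.symm]
  · simp only [pull_sigma, (hst _ _).2.2, map_mul c.2.symm, aut_inv c.2.symm]

/-- The stabiliser `C` of the coupling of `χ` in `Autb H × Autb I`: the pairs `c = (φ, θ)` such
that `χ` and `θ⁻¹ χ_φ θ` define the same coupling. -/
def stabilizer (χ : Triple H I) : Subgroup (RingAut H × RingAut I) where
  carrier := {c | Approx (χ.pull c) χ}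
  one_mem' := Approx.refl χ
  mul_mem' := by
    intro c d hc hd
    exact Approx.trans (Approx.pull (χ := χ) hc d) hd
  inv_mem' := by
    intro c hc
    have h := Approx.pull (χ := χ) hc c⁻¹
    rw [← pull_mul, mul_inv_cancel, pull_one] at h
    exact h.symm

section Cohomology

variable [IsTrivial I]

/-- `σ_h` as an automorphism of `(I, +) = (I, ∘)`, for a trivial skew brace `I`. -/
def sigmaAdd (χ : Triple H I) (h : H) : I ≃+ I where
  toEquiv := (χ.sigma h).toEquiv
  map_add' a b := by
    have e := map_mul (χ.sigma h) a b
    rw [IsTrivial.mul_eq_add, IsTrivial.mul_eq_add] at e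
    exact e

/-- The restrictions of `ν_h`, `μ_h`, `σ_h` and `θ` to the centre `Z(I)`. -/
def nuZ (χ : Triple H I) (h : H) : AddSubgroup.center I ≃+ AddSubgroup.center I :=
  AddSubgroup.centerCongr (χ.nu h)

def muZ (χ : Triple H I) (h : H) : AddSubgroup.center I ≃+ AddSubgroup.center I :=
  AddSubgroup.centerCongr (χ.mu h)

def sigmaZ (χ : Triple H I) (h : H) : AddSubgroup.center I ≃+ AddSubgroup.center I :=
  AddSubgroup.centerCongr (χ.sigmaAdd h)

def autZ (θ : RingAut I) : AddSubgroup.center I ≃+ AddSubgroup.center I :=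
  AddSubgroup.centerCongr θ.toAddEquiv

/-- The group `Z¹_N(H, Z(I))` of derivations. -/
def Z1 (χ : Triple H I) : AddSubgroup (H → AddSubgroup.center I) where
  carrier := {l | ∀ h₁ h₂,
    l (h₁ * h₂) = χ.sigmaZ h₂ (l h₁) + l h₂ ∧
    χ.nuZ (h₁ + h₂) (l (h₁ + h₂)) = χ.muZ h₂ (χ.nuZ h₁ (l h₁)) + χ.nuZ h₂ (l h₂)}
  zero_mem' := by intro h₁ h₂; simp
  add_mem' := by
    intro a b ha hb h₁ h₂
    have h := ha h₁ h₂
    have h' := hb h₁ h₂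
    simp only [Pi.add_apply, map_add]
    grind
  neg_mem' := by
    intro a ha h₁ h₂
    have h := ha h₁ h₂
    simp only [Pi.neg_apply, map_neg]
    grind

/-- The group `Z²_N(H, Z(I))` of normalised 2-cocycles `(g, f)`.  The last condition says that
adding `(g, f)` to the pair `(β, τ)` of a section of an extension preserves the skew brace
identity `a ∘ (b + c) = a ∘ b - a + a ∘ c`. -/
def Z2 (χ : Triple H I) :
    AddSubgroup ((H → H → AddSubgroup.center I) × (H → H → AddSubgroup.center I)) where
  carrier := {z |
    (∀ h, z.1 h 0 = 0 ∧ z.1 0 h = 0 ∧ z.2 h 0 = 0 ∧ z.2 0 h = 0) ∧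
    (∀ h₁ h₂ h₃, z.1 h₁ (h₂ + h₃) + z.1 h₂ h₃ - z.1 (h₁ + h₂) h₃ - χ.muZ h₃ (z.1 h₁ h₂) = 0) ∧
    (∀ h₁ h₂ h₃, z.2 h₁ (h₂ * h₃) + z.2 h₂ h₃ - z.2 (h₁ * h₂) h₃ - χ.sigmaZ h₃ (z.2 h₁ h₂) = 0) ∧
    (∀ h₁ h₂ h₃, χ.nuZ (h₁ * (h₂ + h₃)) (z.2 h₁ (h₂ + h₃)) + χ.nuZ h₁ (z.1 h₂ h₃) =
      z.1 (h₁ * h₂ - h₁) (h₁ * h₃) +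
      χ.muZ (h₁ * h₃) (z.1 (h₁ * h₂) (-h₁) + χ.muZ (-h₁) (χ.nuZ (h₁ * h₂) (z.2 h₁ h₂))
        - z.1 h₁ (-h₁)) +
      χ.nuZ (h₁ * h₃) (z.2 h₁ h₃))}
  zero_mem' := by
    refine ⟨fun h => ?_, fun h₁ h₂ h₃ => ?_, fun h₁ h₂ h₃ => ?_, fun h₁ h₂ h₃ => ?_⟩ <;> simp
  add_mem' := by
    rintro a b ⟨a1, a2, a3, a4⟩ ⟨b1, b2, b3, b4⟩
    refine ⟨fun h => ?_, fun h₁ h₂ h₃ => ?_, fun h₁ h₂ h₃ => ?_, fun h₁ h₂ h₃ => ?_⟩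
    · have e := a1 h
      have e' := b1 h
      simp [e, e']
    · have h := a2 h₁ h₂ h₃
      have h' := b2 h₁ h₂ h₃
      simp only [Prod.fst_add, Pi.add_apply, map_add]
      grind
    · have h := a3 h₁ h₂ h₃
      have h' := b3 h₁ h₂ h₃
      simp only [Prod.snd_add, Pi.add_apply, map_add]
      grind
    · have h := a4 h₁ h₂ h₃
      have h' := b4 h₁ h₂ h₃
      simp only [Prod.snd_add, Prod.fst_add, Pi.add_apply, map_add, map_sub] at h h' ⊢
      grind
  neg_mem' := by
    rintro a ⟨a1, a2, a3, a4⟩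
    refine ⟨fun h => ?_, fun h₁ h₂ h₃ => ?_, fun h₁ h₂ h₃ => ?_, fun h₁ h₂ h₃ => ?_⟩
    · have e := a1 h
      simp [e]
    · have h := a2 h₁ h₂ h₃
      simp only [Prod.fst_neg, Pi.neg_apply, map_neg]
      grind
    · have h := a3 h₁ h₂ h₃
      simp only [Prod.snd_neg, Pi.neg_apply, map_neg]
      grind
    · have h := a4 h₁ h₂ h₃
      simp only [Prod.snd_neg, Prod.fst_neg, Pi.neg_apply, map_add, map_sub, map_neg] at h ⊢
      grind

/-- The subgroup `B²_N(H, Z(I))` of coboundaries. -/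
def B2 (χ : Triple H I) : AddSubgroup χ.Z2 where
  carrier := {z | ∃ t : H → AddSubgroup.center I, ∀ h₁ h₂,
    z.1.1 h₁ h₂ = χ.nuZ (h₁ + h₂) (-t (h₁ + h₂)) + χ.muZ h₂ (χ.nuZ h₁ (t h₁))
      + χ.nuZ h₂ (t h₂) ∧
    z.1.2 h₁ h₂ = -t (h₁ * h₂) + χ.sigmaZ h₂ (t h₁) + t h₂}
  zero_mem' := ⟨0, fun h₁ h₂ => by simp⟩
  add_mem' := by
    rintro a b ⟨t, ht⟩ ⟨r, hr⟩
    refine ⟨t + r, fun h₁ h₂ => ?_⟩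
    have h := ht h₁ h₂
    have h' := hr h₁ h₂
    simp only [AddSubgroup.coe_add, Prod.fst_add, Prod.snd_add, Pi.add_apply, map_add,
      map_neg] at h h' ⊢
    grind
  neg_mem' := by
    rintro a ⟨t, ht⟩
    refine ⟨-t, fun h₁ h₂ => ?_⟩
    have h := ht h₁ h₂
    simp only [NegMemClass.coe_neg, Prod.fst_neg, Prod.snd_neg, Pi.neg_apply, map_neg] at h ⊢
    grind

/-- The second cohomology group `H²_N(H, Z(I)) = Z²_N(H, Z(I)) / B²_N(H, Z(I))`. -/
abbrev H2 (χ : Triple H I) : Type (max u v) := χ.Z2 ⧸ χ.B2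

theorem lam_trivial (a b : I) : lam a b = b := by
  rw [lam, IsTrivial.mul_eq_add, neg_add_cancel_left]

/-- Triples with the same coupling induce the same maps on `Z(I)`. -/
theorem Approx.center {χ' χ : Triple H I} (a : Approx χ' χ) (h : H) (z : AddSubgroup.center I) :
    χ'.nuZ h z = χ.nuZ h z ∧ χ'.muZ h z = χ.muZ h z ∧ χ'.sigmaZ h z = χ.sigmaZ h z := by
  obtain ⟨t, -, ht⟩ := a
  refine ⟨Subtype.ext ?_, Subtype.ext ?_, Subtype.ext ?_⟩
  · have e := (ht h z).1
    rw [lam_trivial] at e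
    exact e
  · have e := (ht h z).2.1
    have hc := AddSubgroup.mem_center_iff.mp (χ.muZ h z).2 (χ.nu h (-t h))
    change χ.nu h (-t h) + χ.mu h z = χ.mu h z + χ.nu h (-t h) at hc
    rw [hc, add_sub_cancel_right] at e
    exact e
  · have e := (ht h z).2.2
    have hc := AddSubgroup.mem_center_iff.mp (χ.sigmaZ h z).2 (t h)
    change t h + χ.sigma h z = χ.sigma h z + t h at hc
    rw [← IsTrivial.mul_eq_add, ← IsTrivial.mul_eq_add] at hc
    rw [mul_assoc, ← hc, inv_mul_cancel_left] at e
    exact e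

theorem stabilizer_apply (χ : Triple H I) {c : RingAut H × RingAut I} (hc : c ∈ χ.stabilizer)
    (h : H) (z : AddSubgroup.center I) :
    χ.nuZ h ((autZ c.2).symm z) = (autZ c.2).symm (χ.nuZ (c.1 h) z) ∧
    χ.muZ h ((autZ c.2).symm z) = (autZ c.2).symm (χ.muZ (c.1 h) z) ∧
    χ.sigmaZ h ((autZ c.2).symm z) = (autZ c.2).symm (χ.sigmaZ (c.1 h) z) := by
  have e := Approx.center hc h ((autZ c.2).symm z)
  have ec : ∀ x, c.2 (c.2.symm x) = x := c.2.apply_symm_apply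
  refine ⟨e.1.symm.trans (Subtype.ext ?_), e.2.1.symm.trans (Subtype.ext ?_),
    e.2.2.symm.trans (Subtype.ext ?_)⟩
  · exact congrArg (fun x => c.2.symm (χ.nu (c.1 h) x)) (ec z)
  · exact congrArg (fun x => c.2.symm (χ.mu (c.1 h) x)) (ec z)
  · exact congrArg (fun x => c.2.symm (χ.sigma (c.1 h) x)) (ec z)

/-- The action of `c = (φ, θ)` on cocycles: `g^c(h₁, h₂) = θ⁻¹(g(φ h₁, φ h₂))`, same for `f`. -/
def actZ2 (χ : Triple H I) (c : χ.stabilizer) : χ.Z2 →+ χ.Z2 where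
  toFun z := ⟨(fun h₁ h₂ => (autZ c.1.2).symm (z.1.1 (c.1.1 h₁) (c.1.1 h₂)),
      fun h₁ h₂ => (autZ c.1.2).symm (z.1.2 (c.1.1 h₁) (c.1.1 h₂))), by
    obtain ⟨⟨g, f⟩, z1, z2, z3, z4⟩ := z
    have hs := χ.stabilizer_apply c.2
    have em : ∀ a b, c.1.1 (a * b) = c.1.1 a * c.1.1 b := map_mul c.1.1
    have ea : ∀ a b, c.1.1 (a + b) = c.1.1 a + c.1.1 b := map_add c.1.1
    have en : ∀ a, c.1.1 (-a) = -c.1.1 a := aut_neg c.1.1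
    have e0 : c.1.1 0 = 0 := aut_zero c.1.1
    have ta : ∀ a b, (autZ c.1.2).symm a + (autZ c.1.2).symm b = (autZ c.1.2).symm (a + b) :=
      fun a b => (map_add _ a b).symm
    have tn : ∀ a, -(autZ c.1.2).symm a = (autZ c.1.2).symm (-a) := fun a => (map_neg _ a).symm
    refine ⟨fun h => ?_, fun h₁ h₂ h₃ => ?_, fun h₁ h₂ h₃ => ?_, fun h₁ h₂ h₃ => ?_⟩
    · have e := z1 (c.1.1 h)
      simp only at e
      simp [e0, e]
    · have e := z2 (c.1.1 h₁) (c.1.1 h₂) (c.1.1 h₃)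
      simp only [sub_eq_add_neg, (hs _ _).2.1, ta, tn, ea]
      simp only [sub_eq_add_neg] at e
      exact (congrArg _ e).trans (map_zero _)
    · have e := z3 (c.1.1 h₁) (c.1.1 h₂) (c.1.1 h₃)
      simp only [sub_eq_add_neg, (hs _ _).2.2, ta, tn, em]
      simp only [sub_eq_add_neg] at e
      exact (congrArg _ e).trans (map_zero _)
    · have e := z4 (c.1.1 h₁) (c.1.1 h₂) (c.1.1 h₃)
      simp only [sub_eq_add_neg, (hs _ _).1, (hs _ _).2.1, ta, tn, em, ea, en]
      simp only [sub_eq_add_neg] at e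
      exact congrArg _ e⟩
  map_zero' := by ext <;> simp
  map_add' a b := by ext <;> simp

theorem actZ2_mem (χ : Triple H I) (c : χ.stabilizer) : χ.B2 ≤ χ.B2.comap (χ.actZ2 c) := by
  rintro z ⟨t, ht⟩
  refine ⟨fun h => (autZ c.1.2).symm (t (c.1.1 h)), fun h₁ h₂ => ?_⟩
  have hs := χ.stabilizer_apply c.2
  have em : ∀ a b, c.1.1 (a * b) = c.1.1 a * c.1.1 b := map_mul c.1.1
  have ea : ∀ a b, c.1.1 (a + b) = c.1.1 a + c.1.1 b := map_add c.1.1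
  have ta : ∀ a b, (autZ c.1.2).symm a + (autZ c.1.2).symm b = (autZ c.1.2).symm (a + b) :=
    fun a b => (map_add _ a b).symm
  have tn : ∀ a, -(autZ c.1.2).symm a = (autZ c.1.2).symm (-a) := fun a => (map_neg _ a).symm
  have e := ht (c.1.1 h₁) (c.1.1 h₂)
  simp only [(hs _ _).1, (hs _ _).2.1, (hs _ _).2.2, ta, tn, ea, em]
  exact ⟨congrArg (autZ c.1.2).symm e.1, congrArg (autZ c.1.2).symm e.2⟩

/-- The (right) action of the stabiliser `C` on `H²_N(H, Z(I))`. -/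
def actH2 (χ : Triple H I) (c : χ.stabilizer) : χ.H2 →+ χ.H2 :=
  QuotientAddGroup.map χ.B2 χ.B2 (χ.actZ2 c) (χ.actZ2_mem c)

theorem actH2_one (χ : Triple H I) (x : χ.H2) : χ.actH2 1 x = x := by
  induction x using QuotientAddGroup.induction_on with
  | H z => rfl

theorem actH2_mul (χ : Triple H I) (c d : χ.stabilizer) (x : χ.H2) :
    χ.actH2 (c * d) x = χ.actH2 d (χ.actH2 c x) := by
  induction x using QuotientAddGroup.induction_on with
  | H z => rfl

end Cohomology

end Triple

/-- An extension `0 → I → E → H → 0` of skew braces. -/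
structure Extension (H : Type u) (I : Type v) [SkewBrace H] [SkewBrace I] where
  Carrier : Type w
  [brace : SkewBrace Carrier]
  i : I → Carrier
  π : Carrier → H
  i_add : ∀ a b, i (a + b) = i a + i b
  i_mul : ∀ a b, i (a * b) = i a * i b
  π_add : ∀ a b, π (a + b) = π a + π b
  π_mul : ∀ a b, π (a * b) = π a * π b
  i_injective : Function.Injective i
  π_surjective : Function.Surjective π
  exact : ∀ x, π x = 0 ↔ x ∈ Set.range i

namespace Extension

set_option linter.unusedSectionVars false

attribute [instance] brace

/-- Equivalence of extensions of `H` by `I`. -/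
def Equivalent (E F : Extension.{u, v, w} H I) : Prop :=
  ∃ e : E.Carrier ≃+* F.Carrier, (∀ y, e (E.i y) = F.i y) ∧ ∀ x, F.π (e x) = E.π x

/-- `s` is a set-theoretic section. -/
def IsSection (E : Extension.{u, v, w} H I) (s : H → E.Carrier) : Prop :=
  (∀ h, E.π (s h) = h) ∧ s 0 = 0

/-- `χ` is the triple corresponding to the section `s`: `ν_h(y) = -s(h) + s(h) ∘ y`,
`μ_h(y) = -s(h) + y + s(h)`, `σ_h(y) = s(h)⁻¹ ∘ y ∘ s(h)`. -/
def Induces (E : Extension.{u, v, w} H I) (s : H → E.Carrier) (χ : Triple H I) : Prop :=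
  ∀ h y, E.i (χ.nu h y) = -s h + s h * E.i y ∧
    E.i (χ.mu h y) = -s h + E.i y + s h ∧
    E.i (χ.sigma h y) = (s h)⁻¹ * E.i y * s h

/-- `[E] ∈ Ext_χ(H, I)`: the coupling of the extension `E` is the coupling of `χ`. -/
def HasCoupling (E : Extension.{u, v, w} H I) (χ : Triple H I) : Prop :=
  ∃ s χ', E.IsSection s ∧ E.Induces s χ' ∧ χ'.Approx χ

/-- For `c = (φ, θ)`: the extension `0 → I → E → H → 0` with maps `i θ` and `φ⁻¹ π`. -/
def pull (E : Extension.{u, v, w} H I) (c : RingAut H × RingAut I) :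
    Extension.{u, v, w} H I where
  Carrier := E.Carrier
  i y := E.i (c.2 y)
  π x := c.1.symm (E.π x)
  i_add a b := by rw [map_add c.2, E.i_add]
  i_mul a b := by rw [map_mul c.2, E.i_mul]
  π_add a b := by rw [E.π_add, map_add c.1.symm]
  π_mul a b := by rw [E.π_mul, map_mul c.1.symm]
  i_injective := E.i_injective.comp c.2.injective
  π_surjective := c.1.symm.surjective.comp E.π_surjective
  exact x := by
    have h : c.1.symm (E.π x) = 0 ↔ E.π x = 0 := by
      constructor
      · intro h
        exact c.1.symm.injective (h.trans (aut_zero c.1.symm).symm)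
      · intro h
        rw [h, aut_zero c.1.symm]
    rw [h, E.exact]
    constructor
    · rintro ⟨y, rfl⟩
      exact ⟨c.2.symm y, congrArg E.i (c.2.apply_symm_apply y)⟩
    · rintro ⟨y, rfl⟩
      exact ⟨_, rfl⟩

/-- `Autb_I(E)`: the automorphisms of the skew brace `E` that map `I` onto `I`. -/
def autI (E : Extension.{u, v, w} H I) : Subgroup (RingAut E.Carrier) where
  carrier := {γ | ∀ x, γ x ∈ Set.range E.i ↔ x ∈ Set.range E.i}
  one_mem' _ := Iff.rfl
  mul_mem' := by
    intro a b ha hb x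
    exact (ha (b x)).trans (hb x)
  inv_mem' := by
    intro a ha x
    have h := ha (a⁻¹ x)
    have e : a (a⁻¹ x) = x := a.apply_symm_apply x
    rw [e] at h
    exact h.symm

theorem i_zero (E : Extension.{u, v, w} H I) : E.i 0 = 0 := by
  have h := E.i_add 0 0
  rw [add_zero] at h
  exact left_eq_add.mp h

theorem i_neg (E : Extension.{u, v, w} H I) (a : I) : E.i (-a) = -E.i a := by
  apply eq_neg_of_add_eq_zero_left
  rw [← E.i_add, neg_add_cancel, E.i_zero]

theorem π_zero (E : Extension.{u, v, w} H I) : E.π 0 = 0 :=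
  (E.exact 0).mpr ⟨0, E.i_zero⟩

theorem π_neg (E : Extension.{u, v, w} H I) (a : E.Carrier) : E.π (-a) = -E.π a := by
  apply eq_neg_of_add_eq_zero_left
  rw [← E.π_add, neg_add_cancel, E.π_zero]

theorem π_inv (E : Extension.{u, v, w} H I) (a : E.Carrier) : E.π a⁻¹ = (E.π a)⁻¹ := by
  apply eq_inv_of_mul_eq_one_left
  rw [← E.π_mul, inv_mul_cancel, one_eq_zero, E.π_zero, one_eq_zero]

theorem π_i (E : Extension.{u, v, w} H I) (y : I) : E.π (E.i y) = 0 := (E.exact _).mpr ⟨y, rfl⟩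

section Twist

variable [IsTrivial I] {χ : Triple H I}

/-- The inclusion of `Z(I)` into `E`. -/
def j (E : Extension.{u, v, w} H I) (z : AddSubgroup.center I) : E.Carrier := E.i z

theorem j_zero (E : Extension.{u, v, w} H I) : E.j 0 = 0 := E.i_zero

theorem j_add (E : Extension.{u, v, w} H I) (a b : AddSubgroup.center I) :
    E.j (a + b) = E.j a + E.j b := E.i_add _ _

theorem j_neg (E : Extension.{u, v, w} H I) (a : AddSubgroup.center I) :
    E.j (-a) = -E.j a := E.i_neg _

theorem j_mul (E : Extension.{u, v, w} H I) (a b : AddSubgroup.center I) :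
    E.j (a + b) = E.j a * E.j b := by
  rw [j, AddSubgroup.coe_add, ← IsTrivial.mul_eq_add, E.i_mul]; rfl

theorem π_j (E : Extension.{u, v, w} H I) (z : AddSubgroup.center I) : E.π (E.j z) = 0 := E.π_i _

/-- The elements of `E` act on `Z(I)` through the maps `ν`, `μ`, `σ`. -/
theorem act_center {E : Extension.{u, v, w} H I} (hE : E.HasCoupling χ) (x : E.Carrier)
    (z : AddSubgroup.center I) :
    x * E.j z = x + E.j (χ.nuZ (E.π x) z) ∧
    E.j z + x = x + E.j (χ.muZ (E.π x) z) ∧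
    E.j z * x = x * E.j (χ.sigmaZ (E.π x) z) := by
  obtain ⟨s, χ', ⟨hs, -⟩, hi, ha⟩ := hE
  obtain ⟨e1, e2, e3⟩ := ha.center (E.π x) z
  rw [← e1, ← e2, ← e3]
  have cen : ∀ (a : AddSubgroup.center I) (y : I), (a : I) + y = y + a :=
    fun a y => (AddSubgroup.mem_center_iff.mp a.2 y).symm
  generalize hh : E.π x = h
  obtain ⟨y, hy⟩ : -s h + x ∈ Set.range E.i := by
    rw [← E.exact, E.π_add, E.π_neg, hs, hh, neg_add_cancel]
  obtain ⟨y', hy'⟩ : (s h)⁻¹ * x ∈ Set.range E.i := by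
    rw [← E.exact, E.π_mul, E.π_inv, hs, hh, inv_mul_cancel, one_eq_zero]
  have hx : x = s h + E.i y := by rw [hy, add_neg_cancel_left]
  have hx' : x = s h * E.i y' := by rw [hy', mul_inv_cancel_left]
  have n : ∀ a, s h * E.i a = s h + E.i (χ'.nu h a) := fun a => by
    rw [(hi h a).1, add_neg_cancel_left]
  refine ⟨?_, ?_, ?_⟩
  · have e : E.j (χ'.nuZ h z) = E.i (χ'.nu h z) := rfl
    rw [e, hx', j, mul_assoc, ← E.i_mul, n, n,
      IsTrivial.mul_eq_add y', map_add, E.i_add, add_assoc]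
  · have e : E.j z + s h = s h + E.j (χ'.muZ h z) := by
      have e' : E.j (χ'.muZ h z) = E.i (χ'.mu h z) := rfl
      rw [e', (hi h z).2.1, add_assoc, add_neg_cancel_left]; rfl
    rw [hx, ← add_assoc, e, add_assoc, add_assoc, j, ← E.i_add, ← E.i_add, cen]
  · have e : E.j z * s h = s h * E.j (χ'.sigmaZ h z) := by
      have e' : E.j (χ'.sigmaZ h z) = E.i (χ'.sigma h z) := rfl
      rw [e', (hi h z).2.2, mul_assoc, mul_inv_cancel_left]; rfl
    rw [hx', ← mul_assoc, e, mul_assoc, mul_assoc, j, ← E.i_mul, ← E.i_mul, IsTrivial.mul_eq_add y',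
      IsTrivial.mul_eq_add _ y', cen]

/-- The skew brace structure `x +' y = x + y + g(π x, π y)`, `x ∘' y = x ∘ y ∘ f(π x, π y)` on
the set `E`, for a cocycle `(g, f)`. -/
@[reducible]
def twistBrace (E : Extension.{u, v, w} H I) (hE : E.HasCoupling χ) (z : χ.Z2) :
    SkewBrace E.Carrier where
  toAddGroup := @AddGroup.ofRightAxioms E.Carrier
    ⟨fun x y => x + y + E.j (z.1.1 (E.π x) (E.π y))⟩
    ⟨fun x => -x + -E.j (z.1.1 (E.π x) (-E.π x))⟩ ⟨0⟩
    (fun a b c => by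
      have e := z.2.2.1 (E.π a) (E.π b) (E.π c)
      change a + b + E.j (z.1.1 (E.π a) (E.π b)) + c +
        E.j (z.1.1 (E.π (a + b + E.j (z.1.1 (E.π a) (E.π b)))) (E.π c)) =
        a + (b + c + E.j (z.1.1 (E.π b) (E.π c))) +
        E.j (z.1.1 (E.π a) (E.π (b + c + E.j (z.1.1 (E.π b) (E.π c)))))
      simp only [E.π_add, E.π_j, add_zero]
      rw [add_assoc (a + b), (act_center hE c _).2.1]
      simp only [add_assoc, ← E.j_add]
      congr 4
      grind)
    (fun a => by
      change a + 0 + E.j (z.1.1 (E.π a) (E.π 0)) = a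
      rw [E.π_zero, (z.2.1 _).1, E.j_zero, add_zero, add_zero])
    (fun a => by
      change a + (-a + -E.j (z.1.1 (E.π a) (-E.π a))) +
        E.j (z.1.1 (E.π a) (E.π (-a + -E.j (z.1.1 (E.π a) (-E.π a))))) = 0
      rw [E.π_add, E.π_neg, E.π_neg, E.π_j, neg_zero, add_zero, add_neg_cancel_left,
        neg_add_cancel])
  toGroup := @Group.ofRightAxioms E.Carrier
    ⟨fun x y => x * y * E.j (z.1.2 (E.π x) (E.π y))⟩
    ⟨fun x => x⁻¹ * (E.j (z.1.2 (E.π x) (E.π x)⁻¹))⁻¹⟩ ⟨1⟩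
    (fun a b c => by
      have e := z.2.2.2.1 (E.π a) (E.π b) (E.π c)
      change a * b * E.j (z.1.2 (E.π a) (E.π b)) * c *
        E.j (z.1.2 (E.π (a * b * E.j (z.1.2 (E.π a) (E.π b)))) (E.π c)) =
        a * (b * c * E.j (z.1.2 (E.π b) (E.π c))) *
        E.j (z.1.2 (E.π a) (E.π (b * c * E.j (z.1.2 (E.π b) (E.π c)))))
      simp only [E.π_mul, E.π_j, mul_zero']
      rw [mul_assoc (a * b), (act_center hE c _).2.2]
      simp only [mul_assoc, ← E.j_mul]
      congr 4
      grind)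
    (fun a => by
      change a * 1 * E.j (z.1.2 (E.π a) (E.π 1)) = a
      rw [one_eq_zero, E.π_zero, (z.2.1 _).2.2.1, E.j_zero, mul_zero', mul_zero'])
    (fun a => by
      change a * (a⁻¹ * (E.j (z.1.2 (E.π a) (E.π a)⁻¹))⁻¹) *
        E.j (z.1.2 (E.π a) (E.π (a⁻¹ * (E.j (z.1.2 (E.π a) (E.π a)⁻¹))⁻¹))) = 1
      rw [E.π_mul, E.π_inv, E.π_inv, E.π_j, ← one_eq_zero, inv_one, mul_one, mul_inv_cancel_left,
        inv_mul_cancel])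
  mul_add_brace a b c := by
    have e := z.2.2.2.2 (E.π a) (E.π b) (E.π c)
    change a * (b + c + E.j (z.1.1 (E.π b) (E.π c))) *
        E.j (z.1.2 (E.π a) (E.π (b + c + E.j (z.1.1 (E.π b) (E.π c))))) =
      a * b * E.j (z.1.2 (E.π a) (E.π b)) + (-a + -E.j (z.1.1 (E.π a) (-E.π a))) +
        E.j (z.1.1 (E.π (a * b * E.j (z.1.2 (E.π a) (E.π b))))
          (E.π (-a + -E.j (z.1.1 (E.π a) (-E.π a))))) +
        a * c * E.j (z.1.2 (E.π a) (E.π c)) +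
        E.j (z.1.1 (E.π (a * b * E.j (z.1.2 (E.π a) (E.π b)) +
          (-a + -E.j (z.1.1 (E.π a) (-E.π a))) +
          E.j (z.1.1 (E.π (a * b * E.j (z.1.2 (E.π a) (E.π b))))
            (E.π (-a + -E.j (z.1.1 (E.π a) (-E.π a)))))))
          (E.π (a * c * E.j (z.1.2 (E.π a) (E.π c)))))
    have m := fun x q => (act_center hE x q).1
    have p := fun x q => (act_center hE x q).2.1
    simp only [m, E.π_add, E.π_mul, E.π_neg, E.π_j, neg_zero, add_zero]
    have l : ∀ q, a * (b + c + E.j q) = a * b + -a + a * c + E.j (χ.nuZ (E.π a) q) := fun q => by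
      rw [mul_add_brace, mul_add_brace, m]
      simp only [sub_eq_add_neg, add_assoc, neg_add_cancel_left]
    have k : ∀ q, a * b + E.j q + (-a + -E.j (z.1.1 (E.π a) (-E.π a))) =
        a * b + (-a + E.j (χ.muZ (-E.π a) q) + -E.j (z.1.1 (E.π a) (-E.π a))) := fun q => by
      rw [add_assoc (a * b), ← add_assoc (E.j _) (-a), p (-a), E.π_neg]
    rw [l, k]
    have r : ∀ (q q' q'' r r' : AddSubgroup.center I),
        a * b + (-a + E.j q + -E.j q') + E.j q'' + (a * c + E.j r) + E.j r' =
        a * b + -a + a * c + E.j (χ.muZ (E.π (a * c)) (q + -q' + q'') + r + r') := by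
      intro q q' q'' r r'
      have h : a * b + (-a + E.j q + -E.j q') + E.j q'' + (a * c + E.j r) + E.j r' =
          a * b + -a + (E.j (q + -q' + q'') + a * c) + E.j r + E.j r' := by
        simp only [E.j_add, E.j_neg, add_assoc]
      rw [h, p]
      simp only [E.j_add, add_assoc]
    rw [r, E.π_mul, add_assoc (a * b + -a + a * c), ← E.j_add]
    congr 2
    rw [sub_eq_add_neg (E.π a * E.π b)] at e
    simp only [map_add, map_sub, map_neg] at e ⊢
    grind

/-- The extension `E^h`, for `h` the class of the cocycle `(g, f)`: if a section `s` of `E` has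
the pair `β(h₁, h₂) = -s(h₁ + h₂) + s(h₁) + s(h₂)`, `τ(h₁, h₂) = s(h₁ ∘ h₂)⁻¹ ∘ s(h₁) ∘ s(h₂)`
then, as a section of the twisted extension, it has the pair `(β + g, τ + f)` and the same triple
(see `twist_triple`). -/
def twist (E : Extension.{u, v, w} H I) (hE : E.HasCoupling χ) (z : χ.Z2) :
    Extension.{u, v, w} H I where
  Carrier := E.Carrier
  brace := E.twistBrace hE z
  i := E.i
  π := E.π
  i_add a b := by
    change E.i (a + b) = E.i a + E.i b + E.j (z.1.1 (E.π (E.i a)) (E.π (E.i b)))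
    rw [E.π_i, E.π_i, (z.2.1 _).1, E.j_zero, add_zero, E.i_add]
  i_mul a b := by
    change E.i (a * b) = E.i a * E.i b * E.j (z.1.2 (E.π (E.i a)) (E.π (E.i b)))
    rw [E.π_i, E.π_i, (z.2.1 _).2.2.1, E.j_zero, mul_zero', E.i_mul]
  π_add a b := by
    change E.π (a + b + E.j (z.1.1 (E.π a) (E.π b))) = E.π a + E.π b
    rw [E.π_add, E.π_j, add_zero, E.π_add]
  π_mul a b := by
    change E.π (a * b * E.j (z.1.2 (E.π a) (E.π b))) = E.π a * E.π b
    rw [E.π_mul, E.π_j, mul_zero', E.π_mul]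
  i_injective := E.i_injective
  π_surjective := E.π_surjective
  exact := E.exact

/-- `(β, τ)` is the pair corresponding to the section `s`. -/
def HasPair (E : Extension.{u, v, w} H I) (s : H → E.Carrier) (β τ : H → H → I) : Prop :=
  ∀ h₁ h₂, E.i (β h₁ h₂) = -s (h₁ + h₂) + s h₁ + s h₂ ∧
    E.i (τ h₁ h₂) = (s (h₁ * h₂))⁻¹ * s h₁ * s h₂

theorem induces_iff (E : Extension.{u, v, w} H I) (s : H → E.Carrier) (χ : Triple H I) :
    E.Induces s χ ↔ ∀ h y, s h + E.i (χ.nu h y) = s h * E.i y ∧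
      s h + E.i (χ.mu h y) = E.i y + s h ∧ s h * E.i (χ.sigma h y) = E.i y * s h := by
  simp only [Induces, eq_neg_add_iff_add_eq, add_assoc, mul_assoc, eq_inv_mul_iff_mul_eq]

theorem hasPair_iff (E : Extension.{u, v, w} H I) (s : H → E.Carrier) (β τ : H → H → I) :
    E.HasPair s β τ ↔ ∀ h₁ h₂, s (h₁ + h₂) + E.i (β h₁ h₂) = s h₁ + s h₂ ∧
      s (h₁ * h₂) * E.i (τ h₁ h₂) = s h₁ * s h₂ := by
  simp only [HasPair, eq_neg_add_iff_add_eq, add_assoc, mul_assoc, eq_inv_mul_iff_mul_eq]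

theorem twist_triple {E : Extension.{u, v, w} H I} (hE : E.HasCoupling χ) (z : χ.Z2)
    {s : H → E.Carrier} (hs : E.IsSection s) {χ' : Triple H I} (hi : E.Induces s χ')
    {β τ : H → H → I} (hp : E.HasPair s β τ) :
    (E.twist hE z).IsSection s ∧ (E.twist hE z).Induces s χ' ∧
    (E.twist hE z).HasPair s (fun h₁ h₂ => β h₁ h₂ + z.1.1 h₁ h₂)
      (fun h₁ h₂ => τ h₁ h₂ + z.1.2 h₁ h₂) := by
  rw [induces_iff] at hi
  rw [hasPair_iff] at hp
  have n := z.2.1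
  have h0 : ∀ y, E.π (E.i y) = 0 := E.π_i
  have hs' := hs.1
  refine ⟨hs, (induces_iff (E.twist hE z) s χ').mpr fun h y => ⟨?_, ?_, ?_⟩,
    (hasPair_iff (E.twist hE z) s _ _).mpr fun h₁ h₂ => ⟨?_, ?_⟩⟩
  · change s h + E.i (χ'.nu h y) + E.j (z.1.1 (E.π (s h)) (E.π (E.i (χ'.nu h y)))) =
      s h * E.i y * E.j (z.1.2 (E.π (s h)) (E.π (E.i y)))
    rw [h0, h0, (n _).1, (n _).2.2.1, E.j_zero, add_zero, mul_zero', (hi h y).1]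
  · change s h + E.i (χ'.mu h y) + E.j (z.1.1 (E.π (s h)) (E.π (E.i (χ'.mu h y)))) =
      E.i y + s h + E.j (z.1.1 (E.π (E.i y)) (E.π (s h)))
    rw [h0, h0, (n _).1, (n _).2.1, E.j_zero, add_zero, add_zero, (hi h y).2.1]
  · change s h * E.i (χ'.sigma h y) * E.j (z.1.2 (E.π (s h)) (E.π (E.i (χ'.sigma h y)))) =
      E.i y * s h * E.j (z.1.2 (E.π (E.i y)) (E.π (s h)))
    rw [h0, h0, (n _).2.2.1, (n _).2.2.2, E.j_zero, mul_zero', mul_zero', (hi h y).2.2]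
  · change s (h₁ + h₂) + E.i (β h₁ h₂ + z.1.1 h₁ h₂) +
      E.j (z.1.1 (E.π (s (h₁ + h₂))) (E.π (E.i (β h₁ h₂ + z.1.1 h₁ h₂)))) =
      s h₁ + s h₂ + E.j (z.1.1 (E.π (s h₁)) (E.π (s h₂)))
    rw [h0, (n _).1, E.j_zero, add_zero, E.i_add, ← add_assoc, (hp h₁ h₂).1, hs', hs']
    rfl
  · change s (h₁ * h₂) * E.i (τ h₁ h₂ + z.1.2 h₁ h₂) *
      E.j (z.1.2 (E.π (s (h₁ * h₂))) (E.π (E.i (τ h₁ h₂ + z.1.2 h₁ h₂)))) =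
      s h₁ * s h₂ * E.j (z.1.2 (E.π (s h₁)) (E.π (s h₂)))
    rw [h0, (n _).2.2.1, E.j_zero, mul_zero', ← IsTrivial.mul_eq_add, E.i_mul, ← mul_assoc,
      (hp h₁ h₂).2, hs', hs']
    rfl

/-- `ω` is the Wells map `ω(E) : C → H²_N(H, Z(I))`: `ω(c)` is the unique class `h` such that
`[E]^c = [E]^h`. -/
def IsWellsMap (E : Extension.{u, v, w} H I) (hE : E.HasCoupling χ)
    (ω : χ.stabilizer → χ.H2) : Prop :=
  ∀ (c : χ.stabilizer) (z : χ.Z2),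
    (E.pull c).Equivalent (E.twist hE z) ↔ (z : χ.H2) = ω c

end Twist

end Extension

end SkewBrace

/-!
The exact sequence rests on three facts about extensions `E`, `F` of `H` by the trivial skew brace `I`.

* *Difference of extensions.* If `E` and `F` have the same coupling, they have sections with the same triple
  (`HasCoupling.exists_section`). Matching the sections gives a bijection `Φ : E → F` over `H` that commutes with
  left and right translations by `I` for both operations (`exists_translation_map`). The defects of
  additivity and multiplicativity of such a `Φ` are central and factor through `H × H`
  (`exists_central_mul_defect`), and the skew brace axioms of `F`, read on `E`, say that they form a cocycle
  (`IsTwistHom.mem_Z2`). Hence `F` is equivalent to a twist of `E`.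
* *Equivalence of twists.* A map over the identity of `H` commuting with translations by `I` has the form
  `x ↦ x ∘ t(π x)` with `t : H → Z(I)` (`exists_center_translation`). It is a homomorphism between the twists
  by `z` and `z'` exactly if `z - z'` is the coboundary of `t` (`twist_equivalent_twist_iff`), and an
  automorphism of `E` exactly if `t` is a derivation (`mem_Z1_iff`). The first statement makes the Wells map
  well defined, and the second is exactness at `Autb_I(E)`.
* *Lifting pairs.* Automorphisms of `E` inducing `c` on `(H, I)` are the equivalences `E → E^c`
  (`equivalent_pull_iff`). Since the coupling does not depend on the section (`HasCoupling.approx`), such `c` lie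
  in the stabiliser, and they are the `c` with `ω(c) = 0`.

The derivation property is obtained by composing the bijections `E → E^c` and `E → E^d`
(`IsWellsMap.map_mul`). For the failure of additivity, take `ℤ/9` as an extension of `ℤ/3` by `ℤ/3` and
`c = (1, -1)`: then `c² = 1`, so that additivity would give `2 ω(c) = 0`, hence `ω(c) = 0` because `H²` is killed
by `3`; but no automorphism of `ℤ/9` induces `c`.
-/

/-! ### Defects of multiplicativity, and couplings of extensions -/

/-- Let `K` and `G` be extensions of the same group by `N`, and let `Φ : G → K` commute with the left and
right translations by `N` and with the projections. The defect of multiplicativity of `Φ` is then a central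
element of `N` which depends only on the classes modulo `N`. -/
@[to_additive]
theorem exists_central_mul_defect {N G K Q : Type*} [Group N] [Group G] [Group K] [Group Q]
    (i : N →* G) (i' : N →* K) (hi' : Function.Injective i') (π : G →* Q) (π' : K →* Q)
    (hπ : Function.Surjective π) (hker : ∀ x, π x = 1 → ∃ y, i y = x)
    (hiker : ∀ y, π (i y) = 1) (hker' : ∀ x, π' x = 1 → ∃ y, i' y = x)
    (Φ : G → K) (hΦ : ∀ x, π' (Φ x) = π x)
    (hr : ∀ x y, Φ (x * i y) = Φ x * i' y) (hl : ∀ x y, Φ (i y * x) = i' y * Φ x) :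
    ∃ c : Q → Q → N, (∀ p q y, y * c p q = c p q * y) ∧
      ∀ x x', Φ (x * x') * i' (c (π x) (π x')) = Φ x * Φ x' := by
  have hd : ∀ x x', ∃ n, Φ (x * x') * i' n = Φ x * Φ x' := fun x x' => by
    obtain ⟨n, hn⟩ := hker' ((Φ (x * x'))⁻¹ * (Φ x * Φ x')) (by simp [hΦ])
    exact ⟨n, by rw [hn, mul_inv_cancel_left]⟩
  -- `N` is normal in `G`
  have hn : ∀ x y, ∃ y', i y * x = x * i y' := fun x y => by
    obtain ⟨n, h⟩ := hker (x⁻¹ * i y * x) (by simp [hiker])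
    exact ⟨n, by rw [h]; group⟩
  have hn' : ∀ x y', ∃ y, i y * x = x * i y' := fun x y => by
    obtain ⟨n, h⟩ := hker (x * i y * x⁻¹) (by simp [hiker])
    exact ⟨n, by rw [h]; group⟩
  -- translating the first factor by `y` amounts to translating the product by a conjugate of `y`
  have key : ∀ x x' y y', i y * (x * x') = x * x' * i y' →
      i' y * (Φ x * Φ x') = Φ x * Φ x' * i' y' := fun x x' y y' h => by
    obtain ⟨z, hz⟩ := hn x y
    obtain ⟨z', hz'⟩ := hn x' z
    have e : i z' = i y' := by
      rw [← mul_assoc, hz, mul_assoc, hz', ← mul_assoc] at h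
      exact mul_left_cancel h
    have e' : i' z' = i' y' := by
      have := hr 1 z'
      rw [e, hr] at this
      exact (mul_left_cancel this).symm
    rw [← mul_assoc, ← hl, hz, hr, mul_assoc, ← hl, hz', hr, e', mul_assoc]
  have hc : ∀ x x' n, Φ (x * x') * i' n = Φ x * Φ x' → ∀ y, y * n = n * y := fun x x' n h y' => by
    obtain ⟨y, hy⟩ := hn' (x * x') y'
    have e := key x x' y y' hy
    rw [← h, ← mul_assoc, ← hl, hy, hr, mul_assoc, mul_assoc] at e
    have e' := mul_left_cancel e
    rw [← map_mul, ← map_mul] at e'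
    exact hi' e'
  obtain ⟨s, hs⟩ := hπ.hasRightInverse
  choose d hd using hd
  refine ⟨fun p q => d (s p) (s q), fun p q => hc _ _ _ (hd _ _), fun x x' => ?_⟩
  obtain ⟨y, hy⟩ := hker ((s (π x))⁻¹ * x) (by simp [hs _])
  obtain ⟨y', hy'⟩ := hker ((s (π x'))⁻¹ * x') (by simp [hs _])
  have hx : x = s (π x) * i y := by rw [hy, mul_inv_cancel_left]
  have hx' : x' = s (π x') * i y' := by rw [hy', mul_inv_cancel_left]
  set a := s (π x)
  set b := s (π x')
  obtain ⟨z, hz⟩ := hn b y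
  have e1 : x * x' = a * b * i (z * y') := by
    rw [hx, hx', map_mul, mul_assoc, ← mul_assoc (i y), hz]; simp only [mul_assoc]
  have e2 : Φ x * Φ x' = Φ a * Φ b * i' (z * y') := by
    rw [hx, hx', hr, hr, mul_assoc, ← mul_assoc (i' y), ← hl, hz, hr, map_mul]
    simp only [mul_assoc]
  rw [e1, e2, hr, ← hd a b, mul_assoc, mul_assoc, ← map_mul, ← map_mul, hc _ _ _ (hd a b)]

namespace SkewBrace

variable {H : Type u} {I : Type v} [SkewBrace H] [SkewBrace I]

namespace Extension

/-- A morphism of extensions over the identities of `I` and `H` is an equivalence (short five lemma). -/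
theorem equivalent_of_hom {E F : Extension.{u, v, w} H I} (Φ : E.Carrier → F.Carrier)
    (ha : ∀ x y, Φ (x + y) = Φ x + Φ y) (hm : ∀ x y, Φ (x * y) = Φ x * Φ y)
    (hi : ∀ y, Φ (E.i y) = F.i y) (hπ : ∀ x, F.π (Φ x) = E.π x) : E.Equivalent F := by
  let f : E.Carrier →+ F.Carrier := AddMonoidHom.mk' Φ ha
  have inj : Function.Injective f := by
    rw [injective_iff_map_eq_zero]
    intro x hx
    change Φ x = 0 at hx
    obtain ⟨y, rfl⟩ := (E.exact x).mp (by rw [← hπ, hx, F.π_zero])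
    rw [hi, ← F.i_zero] at hx
    rw [F.i_injective hx, E.i_zero]
  have surj : Function.Surjective f := fun y => by
    obtain ⟨x, hx⟩ := E.π_surjective (F.π y)
    obtain ⟨w, hw⟩ := (F.exact (-Φ x + y)).mp (by rw [F.π_add, F.π_neg, hπ, hx, neg_add_cancel])
    refine ⟨x + E.i w, ?_⟩
    change Φ (x + E.i w) = y
    rw [ha, hi, hw, add_neg_cancel_left]
  exact ⟨{ Equiv.ofBijective Φ ⟨inj, surj⟩ with map_add' := ha, map_mul' := hm }, hi, hπ⟩

theorem Equivalent.symm {E F : Extension.{u, v, w} H I} (h : E.Equivalent F) : F.Equivalent E := by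
  obtain ⟨e, hi, hπ⟩ := h
  exact ⟨e.symm, fun y => by rw [← hi, e.symm_apply_apply],
    fun x => by rw [← hπ, e.apply_symm_apply]⟩

theorem Equivalent.trans {E F G : Extension.{u, v, w} H I} (h : E.Equivalent F)
    (h' : F.Equivalent G) : E.Equivalent G := by
  obtain ⟨e, hi, hπ⟩ := h
  obtain ⟨e', hi', hπ'⟩ := h'
  exact ⟨e.trans e', fun y => (congrArg e' (hi y)).trans (hi' y),
    fun x => (hπ' (e x)).trans (hπ x)⟩

theorem i_lam (E : Extension.{u, v, w} H I) (a b : I) : E.i (lam a b) = lam (E.i a) (E.i b) := by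
  rw [lam, lam, E.i_add, E.i_neg, E.i_mul]

theorem i_inv (E : Extension.{u, v, w} H I) (a : I) : E.i a⁻¹ = (E.i a)⁻¹ := by
  apply eq_inv_of_mul_eq_one_left
  rw [← E.i_mul, inv_mul_cancel, one_eq_zero, one_eq_zero, E.i_zero]

/-- Replacing a section `s` by `s ∘ t`, for a map `t : H → I`, changes its triple by `t` in the
sense of `Triple.Approx`. -/
theorem induces_mul_iff {E : Extension.{u, v, w} H I} {s : H → E.Carrier} {χ : Triple H I}
    (hs : E.Induces s χ) (t : H → I) (χ' : Triple H I) :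
    E.Induces (fun h => s h * E.i (t h)) χ' ↔ ∀ h y,
      χ'.nu h y = χ.nu h (lam (t h) y) ∧
      χ'.mu h y = χ.nu h (-t h) + χ.mu h y - χ.nu h (-t h) ∧
      χ'.sigma h y = (t h)⁻¹ * χ.sigma h y * t h := by
  refine forall_congr' fun h => forall_congr' fun y => ?_
  have hn : ∀ y, E.i (χ.nu h y) = lam (s h) (E.i y) := fun y => (hs h y).1
  have e : s h * E.i (t h) = s h + E.i (χ.nu h (t h)) := by rw [hn, ← mul_eq]
  have e1 : E.i (χ.nu h (lam (t h) y)) =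
      -(s h * E.i (t h)) + s h * E.i (t h) * E.i y := by
    rw [hn, i_lam, ← lam_mul, lam]
  have e2 : E.i (χ.nu h (-t h) + χ.mu h y - χ.nu h (-t h)) =
      -(s h * E.i (t h)) + E.i y + s h * E.i (t h) := by
    rw [e, map_neg, sub_neg_eq_add, E.i_add, E.i_add, E.i_neg, (hs h y).2.1]
    simp only [neg_add_rev, add_assoc]
  have e3 : E.i ((t h)⁻¹ * χ.sigma h y * t h) =
      (s h * E.i (t h))⁻¹ * E.i y * (s h * E.i (t h)) := by
    rw [E.i_mul, E.i_mul, i_inv, (hs h y).2.2]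
    simp only [mul_inv_rev, mul_assoc]
  rw [← e1, ← e2, ← e3, E.i_injective.eq_iff, E.i_injective.eq_iff, E.i_injective.eq_iff]

/-- Every triple in the coupling of an extension is the triple of a section. -/
theorem HasCoupling.exists_section {E : Extension.{u, v, w} H I} {χ χ' : Triple H I}
    (hE : E.HasCoupling χ) (h : χ'.Approx χ) : ∃ s, E.IsSection s ∧ E.Induces s χ' := by
  obtain ⟨s, χ₁, ⟨hs, hs0⟩, hi, ha⟩ := hE
  obtain ⟨t, ht, hst⟩ := h.trans ha.symm
  refine ⟨fun h => s h * E.i (t h), ⟨fun h => ?_, ?_⟩, (induces_mul_iff hi t χ').mpr hst⟩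
  · rw [E.π_mul, E.π_i, hs, mul_zero']
  · simp only [hs0, ht, E.i_zero, mul_zero']

/-- The coupling of an extension does not depend on the section. -/
theorem HasCoupling.approx {E : Extension.{u, v, w} H I} {χ χ' : Triple H I}
    (hE' : E.HasCoupling χ') (hE : E.HasCoupling χ) : χ'.Approx χ := by
  obtain ⟨s, ⟨hs, hs0⟩, hi⟩ := hE.exists_section (Triple.Approx.refl χ)
  obtain ⟨s', ⟨hs', hs0'⟩, hi'⟩ := hE'.exists_section (Triple.Approx.refl χ')
  have ht : ∀ h, ∃ y, E.i y = (s h)⁻¹ * s' h := fun h => (E.exact _).mp (by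
    rw [E.π_mul, E.π_inv, hs, hs', inv_mul_cancel, one_eq_zero])
  choose t ht using ht
  have e : s' = fun h => s h * E.i (t h) := by
    funext h
    rw [ht, mul_inv_cancel_left]
  rw [e] at hi'
  refine ⟨t, E.i_injective ?_, (induces_mul_iff hi t χ').mp hi'⟩
  rw [ht, hs0, hs0', inv_mul_cancel, one_eq_zero, E.i_zero]

theorem HasCoupling.pull {E : Extension.{u, v, w} H I} {χ : Triple H I}
    (hE : E.HasCoupling χ) (c : RingAut H × RingAut I) : (E.pull c).HasCoupling (χ.pull c) := by
  obtain ⟨s, χ', ⟨hs, hs0⟩, hi, ha⟩ := hE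
  have ec : ∀ x, c.2 (c.2.symm x) = x := c.2.apply_symm_apply
  refine ⟨fun h => s (c.1 h), χ'.pull c, ⟨fun h => ?_, ?_⟩, fun h y => ⟨?_, ?_, ?_⟩, ha.pull c⟩
  · exact (congrArg c.1.symm (hs _)).trans (c.1.symm_apply_apply h)
  · exact (congrArg s (aut_zero c.1)).trans hs0
  · exact (congrArg E.i (ec _)).trans (hi (c.1 h) (c.2 y)).1
  · exact (congrArg E.i (ec _)).trans (hi (c.1 h) (c.2 y)).2.1
  · exact (congrArg E.i (ec _)).trans (hi (c.1 h) (c.2 y)).2.2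

theorem Equivalent.hasCoupling {E F : Extension.{u, v, w} H I} {χ : Triple H I}
    (h : E.Equivalent F) (hE : E.HasCoupling χ) : F.HasCoupling χ := by
  obtain ⟨e, hei, heπ⟩ := h
  obtain ⟨s, χ', ⟨hs, hs0⟩, hi, ha⟩ := hE
  refine ⟨fun h => e (s h), χ', ⟨fun h => ?_, ?_⟩, fun h y => ?_, ha⟩
  · rw [heπ, hs]
  · simp only [hs0, aut_zero]
  · obtain ⟨h1, h2, h3⟩ := hi h y
    simp only [← hei, h1, h2, h3, map_add, map_mul, aut_neg, aut_inv, and_self]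

end Extension

end SkewBrace

/-! ### Extensions with the same coupling differ by a cocycle -/

namespace SkewBrace

variable {H : Type u} {I : Type v} [SkewBrace H] [SkewBrace I]

namespace Extension

/-- Extensions with sections that induce the same triple: matching the two sections gives a map
over `H` that commutes with the translations by `I` on either side, for both operations. -/
theorem exists_translation_map [IsTrivial I] {E F : Extension.{u, v, w} H I} {χ : Triple H I}
    {s : H → E.Carrier} (hs : E.IsSection s) (hi : E.Induces s χ)
    {s' : H → F.Carrier} (hs' : F.IsSection s') (hi' : F.Induces s' χ) :
    ∃ Φ : E.Carrier → F.Carrier, Φ 0 = 0 ∧ (∀ x, F.π (Φ x) = E.π x) ∧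
      (∀ x y, Φ (x + E.i y) = Φ x + F.i y) ∧ (∀ x y, Φ (E.i y + x) = F.i y + Φ x) ∧
      (∀ x y, Φ (x * E.i y) = Φ x * F.i y) ∧ (∀ x y, Φ (E.i y * x) = F.i y * Φ x) := by
  have hu : ∀ x, ∃ y, E.i y = -s (E.π x) + x := fun x => (E.exact _).mp (by
    rw [E.π_add, E.π_neg, hs.1, neg_add_cancel])
  choose u hu using hu
  have hx : ∀ x, x = s (E.π x) + E.i (u x) := fun x => by rw [hu, add_neg_cancel_left]
  obtain ⟨Φ, hΦ⟩ : ∃ Φ : E.Carrier → F.Carrier, ∀ h y, Φ (s h + E.i y) = s' h + F.i y := by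
    refine ⟨fun x => s' (E.π x) + F.i (u x), fun h y => ?_⟩
    have e : E.π (s h + E.i y) = h := by rw [E.π_add, hs.1, E.π_i, add_zero]
    have e' : u (s h + E.i y) = y := E.i_injective (by rw [hu, e, neg_add_cancel_left])
    simp only [e, e']
  rw [induces_iff] at hi hi'
  -- in terms of `x = s h + i y`, the four translations are given by `ν`, `μ` and `σ` alone
  have n : ∀ h y, s h + E.i y = s h * E.i ((χ.nu h).symm y) := fun h y => by
    rw [← (hi h _).1, AddEquiv.apply_symm_apply]
  have n' : ∀ h y, s' h + F.i y = s' h * F.i ((χ.nu h).symm y) := fun h y => by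
    rw [← (hi' h _).1, AddEquiv.apply_symm_apply]
  refine ⟨Φ, ?_, fun x => ?_, fun x y => ?_, fun x y => ?_, fun x y => ?_, fun x y => ?_⟩
  · have e := hΦ 0 0
    rwa [hs.2, hs'.2, E.i_zero, F.i_zero, add_zero, add_zero] at e
  · rw [hx x, hΦ, F.π_add, F.π_i, E.π_add, E.π_i, hs.1, hs'.1]
  · rw [hx x, hΦ, add_assoc, add_assoc, ← E.i_add, ← F.i_add, hΦ]
  · rw [hx x, hΦ, ← add_assoc, ← add_assoc, ← (hi _ _).2.1, ← (hi' _ _).2.1, add_assoc, add_assoc,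
      ← E.i_add, ← F.i_add, hΦ]
  · rw [hx x, hΦ, n, n', mul_assoc, mul_assoc, ← E.i_mul, ← F.i_mul, ← (hi _ _).1, ← (hi' _ _).1, hΦ]
  · rw [hx x, hΦ, n, n', ← mul_assoc, ← mul_assoc, ← (hi _ _).2.2, ← (hi' _ _).2.2, mul_assoc,
      mul_assoc, ← E.i_mul, ← F.i_mul, ← (hi _ _).1, ← (hi' _ _).1, hΦ]

theorem j_injective (E : Extension.{u, v, w} H I) : Function.Injective E.j :=
  E.i_injective.comp Subtype.val_injective

variable [IsTrivial I] {χ : Triple H I}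

/-- `Φ : E → F` is the identity on `I` and on `H`, and is a homomorphism for the operations
`x +' y = x + y + g(π x, π y)` and `x ∘' y = x ∘ y ∘ f(π x, π y)` on `E`. The pair `(g, f)` is not assumed
to be a cocycle, so that `+'` and `∘'` need not be group operations. -/
structure IsTwistHom (E F : Extension.{u, v, w} H I)
    (z : (H → H → AddSubgroup.center I) × (H → H → AddSubgroup.center I))
    (Φ : E.Carrier → F.Carrier) : Prop where
  map_i : ∀ y, Φ (E.i y) = F.i y
  map_π : ∀ x, F.π (Φ x) = E.π x
  map_add : ∀ x y, Φ (x + y + E.j (z.1 (E.π x) (E.π y))) = Φ x + Φ y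
  map_mul : ∀ x y, Φ (x * y * E.j (z.2 (E.π x) (E.π y))) = Φ x * Φ y

theorem twist_equivalent_iff {E F : Extension.{u, v, w} H I} (hE : E.HasCoupling χ) (z : χ.Z2) :
    (E.twist hE z).Equivalent F ↔ ∃ Φ, IsTwistHom E F z.1 Φ := by
  constructor
  · rintro ⟨e, hi, hπ⟩
    exact ⟨e, hi, hπ, e.map_add', e.map_mul'⟩
  · rintro ⟨Φ, h1, h2, h3, h4⟩
    exact equivalent_of_hom (E := E.twist hE z) Φ h3 h4 h1 h2

/-- Extensions with the same coupling differ by some pair of maps `H × H → Z(I)`. -/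
theorem HasCoupling.exists_isTwistHom {E F : Extension.{u, v, w} H I} (hE : E.HasCoupling χ)
    (hF : F.HasCoupling χ) : ∃ z Φ, IsTwistHom E F z Φ ∧ (∀ x y, Φ (x + E.j y) = Φ x + F.j y) ∧
      ∀ x y, Φ (x * E.j y) = Φ x * F.j y := by
  obtain ⟨s, χ', hs, hi, ha⟩ := hE
  obtain ⟨s', hs', hi'⟩ := hF.exists_section ha
  obtain ⟨Φ, h0, hπ, ar, al, mr, ml⟩ := exists_translation_map hs hi hs' hi'
  have ex : ∀ (E : Extension.{u, v, w} H I) x, E.π x = 0 → ∃ y, E.i y = x :=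
    fun E x h => (E.exact x).mp h
  have ex1 : ∀ (E : Extension.{u, v, w} H I) x, E.π x = 1 → ∃ y, E.i y = x :=
    fun E x h => (E.exact x).mp (h.trans one_eq_zero)
  obtain ⟨g, hg, hg'⟩ := exists_central_add_defect (AddMonoidHom.mk' E.i E.i_add)
    (AddMonoidHom.mk' F.i F.i_add) F.i_injective (AddMonoidHom.mk' E.π E.π_add)
    (AddMonoidHom.mk' F.π F.π_add) E.π_surjective (ex E) E.π_i (ex F) Φ hπ ar al
  obtain ⟨f, hf, hf'⟩ := exists_central_mul_defect (MonoidHom.mk' E.i E.i_mul)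
    (MonoidHom.mk' F.i F.i_mul) F.i_injective (MonoidHom.mk' E.π E.π_mul)
    (MonoidHom.mk' F.π F.π_mul) E.π_surjective (ex1 E) (fun y => (E.π_i y).trans one_eq_zero.symm)
    (ex1 F) Φ hπ mr ml
  refine ⟨(fun p q => ⟨g p q, AddSubgroup.mem_center_iff.mpr (hg p q)⟩,
    fun p q => ⟨f p q, AddSubgroup.mem_center_iff.mpr fun y => ?_⟩), Φ, ⟨fun y => ?_, hπ,
    fun x y => (ar _ _).trans (hg' x y), fun x y => (mr _ _).trans (hf' x y)⟩,
    fun x y => ar x y, fun x y => mr x y⟩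
  · rw [← IsTrivial.mul_eq_add, ← IsTrivial.mul_eq_add, hf]
  · have e := ar 0 y
    rwa [zero_add, h0, zero_add] at e

/-- A pair of maps by which two extensions with the same coupling differ is a cocycle: its four conditions
are the neutrality of `0`, the two associativities and the brace identity in `F`. -/
theorem IsTwistHom.mem_Z2 {E F : Extension.{u, v, w} H I} (hE : E.HasCoupling χ)
    {z : (H → H → AddSubgroup.center I) × (H → H → AddSubgroup.center I)}
    {Φ : E.Carrier → F.Carrier} (h : IsTwistHom E F z Φ)
    (ha : ∀ x y, Φ (x + E.j y) = Φ x + F.j y) (hm : ∀ x y, Φ (x * E.j y) = Φ x * F.j y) :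
    z ∈ χ.Z2 := by
  have hadd : ∀ x y, Φ x + Φ y = Φ (x + y + E.j (z.1 (E.π x) (E.π y))) :=
    fun x y => (h.map_add x y).symm
  have hmul : ∀ x y, Φ x * Φ y = Φ (x * y * E.j (z.2 (E.π x) (E.π y))) :=
    fun x y => (h.map_mul x y).symm
  have h0 : Φ 0 = 0 := by rw [← E.i_zero, h.map_i, F.i_zero]
  have ia : ∀ {x a b}, Φ (x + E.j a) = Φ (x + E.j b) → a = b := fun {x a b} e => by
    rw [ha, ha] at e
    exact F.j_injective (add_left_cancel e)
  have im : ∀ {x a b}, Φ (x * E.j a) = Φ (x * E.j b) → a = b := fun {x a b} e => by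
    rw [hm, hm] at e
    exact F.j_injective (mul_left_cancel e)
  have hn := fun x y => (act_center hE x y).1
  have hμ := fun x y => (act_center hE x y).2.1
  have hσ := fun x y => (act_center hE x y).2.2
  have n1 : ∀ p, z.1 p 0 = 0 := fun p => by
    obtain ⟨x, rfl⟩ := E.π_surjective p
    have e := hadd x 0
    rw [h0, E.π_zero, add_zero, add_zero] at e
    apply ia (x := x)
    rw [← e, E.j_zero, add_zero]
  refine ⟨fun p => ⟨n1 p, ?_, ?_, ?_⟩, fun p q r => ?_, fun p q r => ?_, fun p q r => ?_⟩
  · obtain ⟨x, rfl⟩ := E.π_surjective p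
    have e := hadd 0 x
    rw [h0, E.π_zero, zero_add, zero_add] at e
    apply ia (x := x)
    rw [← e, E.j_zero, add_zero]
  · obtain ⟨x, rfl⟩ := E.π_surjective p
    have e := hmul x 0
    rw [h0, E.π_zero, mul_zero', mul_zero'] at e
    apply im (x := x)
    rw [← e, E.j_zero, mul_zero']
  · obtain ⟨x, rfl⟩ := E.π_surjective p
    have e := hmul 0 x
    rw [h0, E.π_zero, zero_mul', zero_mul'] at e
    apply im (x := x)
    rw [← e, E.j_zero, mul_zero']
  · obtain ⟨a, rfl⟩ := E.π_surjective p
    obtain ⟨b, rfl⟩ := E.π_surjective q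
    obtain ⟨c, rfl⟩ := E.π_surjective r
    have e := add_assoc (Φ a) (Φ b) (Φ c)
    simp only [hadd, E.π_add, E.π_j, add_zero] at e
    rw [add_assoc (a + b), hμ c] at e
    simp only [← add_assoc] at e
    simp only [add_assoc _ (E.j _) (E.j _), ← E.j_add] at e
    have e' := ia e
    grind
  · obtain ⟨a, rfl⟩ := E.π_surjective p
    obtain ⟨b, rfl⟩ := E.π_surjective q
    obtain ⟨c, rfl⟩ := E.π_surjective r
    have e := mul_assoc (Φ a) (Φ b) (Φ c)
    simp only [hmul, E.π_mul, E.π_j, mul_zero'] at e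
    rw [mul_assoc (a * b), hσ c] at e
    simp only [← mul_assoc] at e
    simp only [mul_assoc _ (E.j _) (E.j _), ← E.j_mul] at e
    have e' := im e
    grind
  · obtain ⟨a, rfl⟩ := E.π_surjective p
    obtain ⟨b, rfl⟩ := E.π_surjective q
    obtain ⟨c, rfl⟩ := E.π_surjective r
    have neg : -Φ a = Φ (-a + E.j (-z.1 (E.π a) (-E.π a))) := by
      apply neg_eq_of_add_eq_zero_right
      rw [hadd, E.π_add, E.π_neg, E.π_j, add_zero, add_neg_cancel_left, ← E.j_add,
        neg_add_cancel, E.j_zero, h0]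
    have e := mul_add_brace (Φ a) (Φ b) (Φ c)
    rw [sub_eq_add_neg, neg] at e
    simp only [hadd, hmul, E.π_add, E.π_mul, E.π_neg, E.π_j, add_zero] at e
    have l : ∀ q q', a * (b + c + E.j q) * E.j q' = a * b + -a + a * c +
        E.j (χ.nuZ (E.π a) q + χ.nuZ (E.π (a * (b + c))) q') := fun q q' => by
      have h1 : a * (b + c + E.j q) = a * (b + c) + E.j (χ.nuZ (E.π a) q) := by
        rw [mul_add_brace, hn, sub_eq_add_neg, add_assoc, neg_add_cancel_left]
      rw [hn, h1, E.π_add, E.π_j, add_zero, E.j_add, ← add_assoc, mul_add_brace, sub_eq_add_neg]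
    have r : ∀ q₁ q₂ q₃ q₄ q₅, a * b * E.j q₁ + (-a + E.j q₂) + E.j q₃ + a * c * E.j q₄ + E.j q₅ =
        a * b + -a + a * c + E.j (χ.muZ (E.π (a * c)) (χ.muZ (E.π (-a)) (χ.nuZ (E.π (a * b)) q₁) +
          q₂ + q₃) + χ.nuZ (E.π (a * c)) q₄ + q₅) := fun q₁ q₂ q₃ q₄ q₅ => by
      rw [hn (a * b), hn (a * c), add_assoc (a * b), ← add_assoc (E.j _) (-a), hμ (-a)]
      simp only [E.j_add, add_assoc]
      congr 2
      simp only [← add_assoc, ← E.j_add]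
      rw [hμ (a * c), add_assoc, ← E.j_add, ← add_assoc (χ.muZ _ _)]
    rw [l, r] at e
    have e' := ia e
    simp only [E.π_add, E.π_mul, E.π_neg, mul_zero', sub_eq_add_neg, _root_.map_add] at e' ⊢
    rw [add_comm, e']
    abel

end Extension

end SkewBrace

/-! ### Equivalence of twists and the Wells map -/

namespace SkewBrace

variable {H : Type u} {I : Type v} [SkewBrace H] [SkewBrace I] {χ : Triple H I}

namespace Extension

theorem HasCoupling.pull_stabilizer {E : Extension.{u, v, w} H I} (hE : E.HasCoupling χ)
    (c : χ.stabilizer) : (E.pull c).HasCoupling χ := by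
  obtain ⟨s, χ', hs, hi, ha⟩ := hE.pull c.1
  exact ⟨s, χ', hs, hi, ha.trans c.2⟩

variable [IsTrivial I]

theorem HasCoupling.exists_twist_equivalent {E F : Extension.{u, v, w} H I} (hE : E.HasCoupling χ)
    (hF : F.HasCoupling χ) : ∃ z : χ.Z2, (E.twist hE z).Equivalent F := by
  obtain ⟨z, Φ, h, ha, hm⟩ := hE.exists_isTwistHom hF
  exact ⟨⟨z, h.mem_Z2 hE ha hm⟩, (twist_equivalent_iff hE _).mpr ⟨Φ, h⟩⟩

theorem twist_zero_equivalent {E : Extension.{u, v, w} H I} (hE : E.HasCoupling χ) :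
    (E.twist hE 0).Equivalent E :=
  (twist_equivalent_iff hE 0).mpr ⟨id, fun _ => rfl, fun _ => rfl,
    fun x y => by change x + y + E.j 0 = x + y; rw [E.j_zero, add_zero],
    fun x y => by change x * y * E.j 0 = x * y; rw [E.j_zero, mul_zero']⟩

/-- A map over the identity of `H` that commutes with the translations by `I` on either side multiplies each
fibre of `π` by a central element of `I`. -/
theorem exists_center_translation {E : Extension.{u, v, w} H I} (e : E.Carrier → E.Carrier)
    (hr : ∀ x y, e (x * E.i y) = e x * E.i y) (hl : ∀ x y, e (E.i y * x) = E.i y * e x)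
    (hπ : ∀ x, E.π (e x) = E.π x) :
    ∃ t : H → AddSubgroup.center I, ∀ x, e x = x * E.j (t (E.π x)) := by
  have hker : ∀ x y, E.π x = E.π y → ∃ w, E.i w = x⁻¹ * y := fun x y h => (E.exact _).mp (by
    rw [E.π_mul, E.π_inv, h, inv_mul_cancel, one_eq_zero])
  choose u hu using fun x => hker x (e x) (hπ x).symm
  have he : ∀ x, e x = x * E.i (u x) := fun x => by rw [hu, mul_inv_cancel_left]
  have hc : ∀ x, u x ∈ AddSubgroup.center I := fun x => AddSubgroup.mem_center_iff.mpr fun y => by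
    obtain ⟨y', hy'⟩ := (E.exact (x * E.i y * x⁻¹)).mp (by
      rw [E.π_mul, E.π_mul, E.π_i, E.π_inv, mul_zero', mul_inv_cancel, one_eq_zero])
    have h1 := hl x y'
    rw [hy', inv_mul_cancel_right, hr, he, mul_assoc, mul_assoc, inv_mul_cancel_left, mul_assoc] at h1
    have h2 := mul_left_cancel h1
    rw [← E.i_mul, ← E.i_mul, IsTrivial.mul_eq_add, IsTrivial.mul_eq_add] at h2
    exact (E.i_injective h2).symm
  obtain ⟨s, hs⟩ := E.π_surjective.hasRightInverse
  refine ⟨fun h => ⟨u (s h), hc _⟩, fun x => ?_⟩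
  obtain ⟨w, hw⟩ := hker (s (E.π x)) x (hs _)
  have hx : x = s (E.π x) * E.i w := by rw [hw, mul_inv_cancel_left]
  have cen := AddSubgroup.mem_center_iff.mp (hc (s (E.π x))) w
  change e x = x * E.i (u (s (E.π x)))
  generalize s (E.π x) = a at *
  rw [hx, hr, he a, mul_assoc, mul_assoc, ← E.i_mul, ← E.i_mul,
    IsTrivial.mul_eq_add w, IsTrivial.mul_eq_add (u a), cen]

theorem center_translation_add_iff {E : Extension.{u, v, w} H I} (hE : E.HasCoupling χ)
    (t : H → AddSubgroup.center I) (g g' : H → H → AddSubgroup.center I) :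
    (∀ x y, (x + y + E.j (g (E.π x) (E.π y))) * E.j (t (E.π x + E.π y)) =
      x * E.j (t (E.π x)) + y * E.j (t (E.π y)) + E.j (g' (E.π x) (E.π y))) ↔
    ∀ p q, g p q + χ.nuZ (p + q) (t (p + q)) =
      χ.muZ q (χ.nuZ p (t p)) + χ.nuZ q (t q) + g' p q := by
  have key : ∀ x y, (x + y + E.j (g (E.π x) (E.π y))) * E.j (t (E.π x + E.π y)) =
      x * E.j (t (E.π x)) + y * E.j (t (E.π y)) + E.j (g' (E.π x) (E.π y)) ↔
      g (E.π x) (E.π y) + χ.nuZ (E.π x + E.π y) (t (E.π x + E.π y)) =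
      χ.muZ (E.π y) (χ.nuZ (E.π x) (t (E.π x))) + χ.nuZ (E.π y) (t (E.π y)) +
        g' (E.π x) (E.π y) := fun x y => by
    have hn := fun x y => (act_center hE x y).1
    have hμ := fun x y => (act_center hE x y).2.1
    rw [hn, hn, hn, add_assoc x (E.j _), ← add_assoc (E.j _) y, hμ]
    simp only [E.π_add, E.π_j, add_zero, add_assoc, add_right_inj, ← E.j_add,
      E.j_injective.eq_iff]
  simp only [key, E.π_surjective.forall]

theorem center_translation_mul_iff {E : Extension.{u, v, w} H I} (hE : E.HasCoupling χ)
    (t : H → AddSubgroup.center I) (f f' : H → H → AddSubgroup.center I) :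
    (∀ x y, (x * y * E.j (f (E.π x) (E.π y))) * E.j (t (E.π x * E.π y)) =
      x * E.j (t (E.π x)) * (y * E.j (t (E.π y))) * E.j (f' (E.π x) (E.π y))) ↔
    ∀ p q, f p q + t (p * q) = χ.sigmaZ q (t p) + t q + f' p q := by
  have key : ∀ x y, (x * y * E.j (f (E.π x) (E.π y))) * E.j (t (E.π x * E.π y)) =
      x * E.j (t (E.π x)) * (y * E.j (t (E.π y))) * E.j (f' (E.π x) (E.π y)) ↔
      f (E.π x) (E.π y) + t (E.π x * E.π y) =
      χ.sigmaZ (E.π y) (t (E.π x)) + t (E.π y) + f' (E.π x) (E.π y) := fun x y => by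
    have hσ := fun x y => (act_center hE x y).2.2
    rw [mul_assoc x (E.j _), ← mul_assoc (E.j _) y, hσ]
    simp only [mul_assoc, mul_right_inj, ← E.j_mul, add_assoc, E.j_injective.eq_iff]
  simp only [key, E.π_surjective.forall]

/-- Twists of the same extension are equivalent exactly if the cocycles are cohomologous: an equivalence is a
translation by some `t : H → Z(I)`, whose coboundary is the difference of the cocycles. -/
theorem twist_equivalent_twist_iff {E : Extension.{u, v, w} H I} (hE : E.HasCoupling χ)
    (z z' : χ.Z2) :
    (E.twist hE z).Equivalent (E.twist hE z') ↔ (z : χ.H2) = (z' : χ.H2) := by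
  have hB : (z : χ.H2) = (z' : χ.H2) ↔ ∃ t : H → AddSubgroup.center I,
      (∀ p q, z.1.1 p q + χ.nuZ (p + q) (t (p + q)) =
        χ.muZ q (χ.nuZ p (t p)) + χ.nuZ q (t q) + z'.1.1 p q) ∧
      ∀ p q, z.1.2 p q + t (p * q) = χ.sigmaZ q (t p) + t q + z'.1.2 p q := by
    rw [eq_comm, QuotientAddGroup.eq]
    refine exists_congr fun t => ?_
    rw [← forall_and]
    refine forall_congr' fun p => ?_
    rw [← forall_and]
    refine forall_congr' fun q => ?_
    change -z'.1.1 p q + z.1.1 p q = _ ∧ -z'.1.2 p q + z.1.2 p q = _ ↔ _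
    rw [_root_.map_neg]
    clear hE
    refine and_congr ⟨fun h => ?_, fun h => ?_⟩ ⟨fun h => ?_, fun h => ?_⟩ <;> grind
  have hT : (E.twist hE z).Equivalent (E.twist hE z') ↔ ∃ Φ : E.Carrier → E.Carrier,
      (∀ y, Φ (E.i y) = E.i y) ∧ (∀ x, E.π (Φ x) = E.π x) ∧
      (∀ x y, Φ (x + y + E.j (z.1.1 (E.π x) (E.π y))) =
        Φ x + Φ y + E.j (z'.1.1 (E.π (Φ x)) (E.π (Φ y)))) ∧
      ∀ x y, Φ (x * y * E.j (z.1.2 (E.π x) (E.π y))) =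
        Φ x * Φ y * E.j (z'.1.2 (E.π (Φ x)) (E.π (Φ y))) :=
    (twist_equivalent_iff hE z).trans
      ⟨fun ⟨Φ, h⟩ => ⟨Φ, h.1, h.2, h.3, h.4⟩, fun ⟨Φ, h1, h2, h3, h4⟩ => ⟨Φ, h1, h2, h3, h4⟩⟩
  rw [hB, hT]
  simp only [← center_translation_add_iff hE, ← center_translation_mul_iff hE]
  constructor
  · rintro ⟨Φ, hi, hπ, ha, hm⟩
    simp only [hπ] at ha hm
    obtain ⟨t, ht⟩ := exists_center_translation Φ (fun x y => by
        have := hm x (E.i y)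
        rwa [E.π_i, (z.2.1 _).2.2.1, (z'.2.1 _).2.2.1, E.j_zero, mul_zero', mul_zero', hi] at this)
      (fun x y => by
        have := hm (E.i y) x
        rwa [E.π_i, (z.2.1 _).2.2.2, (z'.2.1 _).2.2.2, E.j_zero, mul_zero', mul_zero', hi] at this)
      hπ
    simp only [ht, E.π_add, E.π_mul, E.π_j, add_zero, mul_zero'] at ha hm
    exact ⟨t, ha, hm⟩
  · rintro ⟨t, ha, hm⟩
    -- the normalisation `f(0, 0) = 0` forces `t` to be normalised
    have t0 : t 0 = 0 := by
      have e := (center_translation_mul_iff hE t z.1.2 z'.1.2).mp hm 0 0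
      rw [(z.2.1 0).2.2.1, (z'.2.1 0).2.2.1, mul_zero', zero_add, add_zero, right_eq_add] at e
      exact (map_eq_zero_iff _ (χ.sigmaZ 0).injective).mp e
    have hp : ∀ x, E.π (x * E.j (t (E.π x))) = E.π x := fun x => by
      rw [E.π_mul, E.π_j, mul_zero']
    refine ⟨fun x => x * E.j (t (E.π x)), fun y => ?_, hp, fun x y => ?_, fun x y => ?_⟩
    · simp only [E.π_i, t0, E.j_zero, mul_zero']
    · simpa only [hp, E.π_add, E.π_j, add_zero] using ha x y
    · simpa only [hp, E.π_mul, E.π_j, mul_zero'] using hm x y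

theorem exists_isWellsMap {E : Extension.{u, v, w} H I} (hE : E.HasCoupling χ) :
    ∃ ω, E.IsWellsMap hE ω := by
  choose k hk using fun c : χ.stabilizer => hE.exists_twist_equivalent (hE.pull_stabilizer c)
  refine ⟨fun c => (k c : χ.H2), fun c z => ?_⟩
  rw [eq_comm, ← twist_equivalent_twist_iff hE]
  exact ⟨(hk c).trans, (hk c).symm.trans⟩

theorem IsWellsMap.exists_isTwistHom {E : Extension.{u, v, w} H I} {hE : E.HasCoupling χ}
    {ω : χ.stabilizer → χ.H2} (hω : E.IsWellsMap hE ω) (c : χ.stabilizer) :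
    ∃ z : χ.Z2, (z : χ.H2) = ω c ∧ ∃ Φ, IsTwistHom E (E.pull c) z.1 Φ := by
  obtain ⟨z, hz⟩ := QuotientAddGroup.mk_surjective (ω c)
  exact ⟨z, hz, (twist_equivalent_iff hE z).mp ((hω c z).mpr hz).symm⟩

theorem IsWellsMap.eq_zero_iff {E : Extension.{u, v, w} H I} {hE : E.HasCoupling χ}
    {ω : χ.stabilizer → χ.H2} (hω : E.IsWellsMap hE ω) (c : χ.stabilizer) :
    ω c = 0 ↔ E.Equivalent (E.pull c) := by
  have h := hω c 0
  rw [eq_comm]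
  refine h.symm.trans ⟨fun h => ?_, fun h => ?_⟩
  · exact (h.trans (twist_zero_equivalent hE)).symm
  · exact h.symm.trans (twist_zero_equivalent hE).symm

/-- The derivation property: if `Φ_c : E → E^c` and `Φ_d : E → E^d` exhibit the classes `ω(c)` and `ω(d)`,
the composite `Φ_c ∘ Φ_d : E → E^(cd)` exhibits `ω(c)^d + ω(d)`. -/
theorem IsWellsMap.map_mul {E : Extension.{u, v, w} H I} {hE : E.HasCoupling χ}
    {ω : χ.stabilizer → χ.H2} (hω : E.IsWellsMap hE ω) (c d : χ.stabilizer) :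
    ω (c * d) = χ.actH2 d (ω c) + ω d := by
  obtain ⟨z, hz, Φ, h⟩ := hω.exists_isTwistHom c
  obtain ⟨z', hz', Φ', h'⟩ := hω.exists_isTwistHom d
  rw [← hz, ← hz']
  refine ((hω (c * d) (χ.actZ2 d z + z')).mp (Equivalent.symm ?_)).symm
  refine (twist_equivalent_iff hE _).mpr ⟨fun x => Φ (Φ' x), fun y => ?_, fun x => ?_,
    fun x y => ?_, fun x y => ?_⟩
  · exact (congrArg Φ (h'.map_i y)).trans (h.map_i _)
  · exact (congrArg d.1.1.symm (h.map_π (Φ' x))).trans (h'.map_π x)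
  all_goals
    have hp : ∀ x, E.π (Φ' x) = d.1.1 (E.π x) := fun x => by
      rw [← h'.map_π x]
      exact (d.1.1.apply_symm_apply _).symm
    -- the inclusion of `Z(I)` into `E^d` undoes the twist by `θ⁻¹` in the action on cocycles
    have hj : ∀ q, (E.pull d).j ((Triple.autZ d.1.2).symm q) = E.j q := fun q =>
      congrArg E.i (d.1.2.apply_symm_apply q.1)
  · have hr : ∀ x q, Φ' (x + E.j q) = Φ' x + (E.pull d).j q := fun x q => by
      have e := h'.map_add x (E.j q)
      rw [E.π_j, (z'.2.1 _).1, E.j_zero, add_zero] at e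
      exact e.trans (congrArg _ (h'.map_i q))
    change Φ (Φ' (x + y + E.j ((Triple.autZ d.1.2).symm (z.1.1 (d.1.1 (E.π x)) (d.1.1 (E.π y))) +
      z'.1.1 (E.π x) (E.π y)))) = _
    rw [add_comm, E.j_add, ← add_assoc, hr, h'.map_add, hj, ← hp, ← hp]
    exact h.map_add _ _
  · have hr : ∀ x q, Φ' (x * E.j q) = Φ' x * (E.pull d).j q := fun x q => by
      have e := h'.map_mul x (E.j q)
      rw [E.π_j, (z'.2.1 _).2.2.1, E.j_zero, mul_zero'] at e
      exact e.trans (congrArg _ (h'.map_i q))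
    change Φ (Φ' (x * y * E.j ((Triple.autZ d.1.2).symm (z.1.2 (d.1.1 (E.π x)) (d.1.1 (E.π y))) +
      z'.1.2 (E.π x) (E.π y)))) = _
    rw [add_comm, E.j_mul, ← mul_assoc, hr, h'.map_mul, hj, ← hp, ← hp]
    exact h.map_mul _ _

end Extension

end SkewBrace

/-! ### Automorphisms of an extension and exactness -/

namespace SkewBrace

variable {H : Type u} {I : Type v} [SkewBrace H] [SkewBrace I]

namespace Extension

/-- `γ : E → E` induces `φ` on `H` and `θ` on `I`, for `c = (φ, θ)`. -/
def InducesPair (E : Extension.{u, v, w} H I) (γ : E.Carrier → E.Carrier)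
    (c : RingAut H × RingAut I) : Prop :=
  (∀ x, E.π (γ x) = c.1 (E.π x)) ∧ ∀ y, γ (E.i y) = E.i (c.2 y)

theorem InducesPair.unique {E : Extension.{u, v, w} H I} {γ : E.Carrier → E.Carrier}
    {c d : RingAut H × RingAut I} (hc : E.InducesPair γ c) (hd : E.InducesPair γ d) : c = d := by
  refine Prod.ext (RingEquiv.ext fun h => ?_) (RingEquiv.ext fun y => E.i_injective ?_)
  · obtain ⟨x, rfl⟩ := E.π_surjective h
    rw [← hc.1, hd.1]
  · rw [← hc.2, hd.2]

theorem exists_inducesPair (E : Extension.{u, v, w} H I) (γ : E.autI) :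
    ∃ c, E.InducesPair γ.1 c := by
  have hH : ∀ γ : E.autI, ∃ φ : H → H, ∀ x, E.π (γ.1 x) = φ (E.π x) := fun γ => by
    obtain ⟨s, hs⟩ := E.π_surjective.hasRightInverse
    refine ⟨fun h => E.π (γ.1 (s h)), fun x => ?_⟩
    have h1 : -s (E.π x) + x ∈ Set.range E.i := by
      rw [← E.exact, E.π_add, E.π_neg, hs, neg_add_cancel]
    have h2 := (γ.2 _).mpr h1
    rw [← E.exact, map_add, aut_neg, E.π_add, E.π_neg] at h2
    exact (neg_add_eq_zero.mp h2).symm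
  have hI : ∀ γ : E.autI, ∃ θ : I → I, ∀ y, γ.1 (E.i y) = E.i (θ y) := fun γ => by
    choose θ hθ using fun y => (γ.2 (E.i y)).mpr ⟨y, rfl⟩
    exact ⟨θ, fun y => (hθ y).symm⟩
  choose φ hφ using hH
  choose θ hθ using hI
  have inv : ∀ (γ : E.autI) x, γ⁻¹.1 (γ.1 x) = x := fun γ x => γ.1.symm_apply_apply x
  have φinv : ∀ (γ : E.autI) h, φ γ⁻¹ (φ γ h) = h := fun γ h => by
    obtain ⟨x, rfl⟩ := E.π_surjective h
    rw [← hφ, ← hφ, inv]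
  have θinv : ∀ (γ : E.autI) y, θ γ⁻¹ (θ γ y) = y := fun γ y => E.i_injective (by
    rw [← hθ, ← hθ, inv])
  have inv' : ∀ (γ : E.autI) x, γ.1 (γ⁻¹.1 x) = x := fun γ x => γ.1.apply_symm_apply x
  have φinv' : ∀ (γ : E.autI) h, φ γ (φ γ⁻¹ h) = h := fun γ h => by
    obtain ⟨x, rfl⟩ := E.π_surjective h
    rw [← hφ, ← hφ, inv']
  have θinv' : ∀ (γ : E.autI) y, θ γ (θ γ⁻¹ y) = y := fun γ y => E.i_injective (by
    rw [← hθ, ← hθ, inv'])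
  let φe : RingAut H :=
    { toFun := φ γ
      invFun := φ γ⁻¹
      left_inv := φinv γ
      right_inv := φinv' γ
      map_add' := E.π_surjective.forall₂.mpr fun x y => by
        rw [← E.π_add, ← hφ, ← hφ, ← hφ, map_add, E.π_add]
      map_mul' := E.π_surjective.forall₂.mpr fun x y => by
        rw [← E.π_mul, ← hφ, ← hφ, ← hφ, map_mul, E.π_mul] }
  let θe : RingAut I :=
    { toFun := θ γ
      invFun := θ γ⁻¹
      left_inv := θinv γ
      right_inv := θinv' γ
      map_add' := fun a b => E.i_injective (by
        rw [E.i_add, ← hθ, ← hθ, ← hθ, E.i_add, map_add])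
      map_mul' := fun a b => E.i_injective (by
        rw [E.i_mul, ← hθ, ← hθ, ← hθ, E.i_mul, map_mul]) }
  exact ⟨(φe, θe), hφ γ, hθ γ⟩

/-- Automorphisms of `E` that induce `c` are the same as equivalences `E → E^c`. -/
theorem equivalent_pull_iff (E : Extension.{u, v, w} H I) (c : RingAut H × RingAut I) :
    E.Equivalent (E.pull c) ↔ ∃ γ : E.autI, E.InducesPair γ.1 c := by
  constructor
  · rintro ⟨e, hi, hπ⟩
    replace hπ : ∀ x, E.π (e x) = c.1 (E.π x) := fun x => by
      rw [← hπ x]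
      exact (c.1.apply_symm_apply _).symm
    refine ⟨⟨e, fun x => ?_⟩, hπ, hi⟩
    rw [← E.exact, ← E.exact]
    exact Eq.congr_left (hπ x) |>.trans (map_eq_zero_iff c.1.toAddEquiv c.1.injective)
  · rintro ⟨γ, hπ, hi⟩
    exact ⟨γ.1, hi, fun x => (congrArg c.1.symm (hπ x)).trans (c.1.symm_apply_apply _)⟩

variable {χ : Triple H I}

theorem InducesPair.mem_stabilizer {E : Extension.{u, v, w} H I} (hE : E.HasCoupling χ)
    {γ : E.autI} {c : RingAut H × RingAut I} (h : E.InducesPair γ.1 c) : c ∈ χ.stabilizer :=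
  (hE.pull c).approx (((E.equivalent_pull_iff c).mpr ⟨γ, h⟩).hasCoupling hE)

theorem exists_inducedHom {E : Extension.{u, v, w} H I} (hE : E.HasCoupling χ) :
    ∃ ρ : E.autI →* χ.stabilizer, ∀ γ, E.InducesPair γ.1 (ρ γ).1 := by
  choose c hc using E.exists_inducesPair
  refine ⟨MonoidHom.mk' (fun γ => ⟨c γ, (hc γ).mem_stabilizer hE⟩) fun γ δ => Subtype.ext ?_, hc⟩
  refine (hc (γ * δ)).unique ⟨fun x => ?_, fun y => ?_⟩
  · exact ((hc γ).1 (δ.1 x)).trans (congrArg _ ((hc δ).1 x))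
  · exact (congrArg γ.1 ((hc δ).2 y)).trans ((hc γ).2 _)

variable [IsTrivial I]

/-- The translation by `l : H → Z(I)` along the fibres of `π` is an automorphism exactly if `l` is a derivation. -/
theorem mem_Z1_iff {E : Extension.{u, v, w} H I} (hE : E.HasCoupling χ)
    (l : H → AddSubgroup.center I) :
    l ∈ χ.Z1 ↔
      (∀ x y, (x + y) * E.j (l (E.π (x + y))) = x * E.j (l (E.π x)) + y * E.j (l (E.π y))) ∧
      ∀ x y, x * y * E.j (l (E.π (x * y))) = x * E.j (l (E.π x)) * (y * E.j (l (E.π y))) := by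
  have ha := center_translation_add_iff hE l 0 0
  have hm := center_translation_mul_iff hE l 0 0
  simp only [Pi.zero_apply, E.j_zero, add_zero, mul_zero', zero_add] at ha hm
  simp only [E.π_add, E.π_mul]
  rw [ha, hm]
  exact ⟨fun h => ⟨fun p q => (h p q).2, fun p q => (h p q).1⟩, fun h p q => ⟨h.2 p q, h.1 p q⟩⟩

theorem exists_derivationHom {E : Extension.{u, v, w} H I} (hE : E.HasCoupling χ) :
    ∃ ψ : Multiplicative χ.Z1 →* E.autI, ∀ (l : χ.Z1) (x : E.Carrier),
      (ψ (Multiplicative.ofAdd l)).1 x = x * E.j (l.1 (E.π x)) := by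
  have hp : ∀ (x : E.Carrier) z, E.π (x * E.j z) = E.π x := fun x z => by
    rw [E.π_mul, E.π_j, mul_zero']
  let e (l : χ.Z1) : RingAut E.Carrier :=
    { toFun := fun x => x * E.j (l.1 (E.π x))
      invFun := fun x => x * E.j (-l.1 (E.π x))
      left_inv := fun x => by
        simp only [hp]
        rw [mul_assoc, ← E.j_mul, add_neg_cancel, E.j_zero, mul_zero']
      right_inv := fun x => by
        simp only [hp]
        rw [mul_assoc, ← E.j_mul, neg_add_cancel, E.j_zero, mul_zero']
      map_add' := ((mem_Z1_iff hE l.1).mp l.2).1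
      map_mul' := ((mem_Z1_iff hE l.1).mp l.2).2 }
  have he : ∀ l x, e l x = x * E.j (l.1 (E.π x)) := fun l x => rfl
  refine ⟨MonoidHom.mk' (fun l => ⟨e l.toAdd, fun x => ?_⟩) fun l l' => ?_, he⟩
  · rw [← E.exact, ← E.exact, he, hp]
  · refine Subtype.ext (RingEquiv.ext fun x => ?_)
    change e (l.toAdd + l'.toAdd) x = e l.toAdd (e l'.toAdd x)
    rw [he, he, he, hp, mul_assoc, ← E.j_mul, add_comm]
    rfl

/-- An automorphism that induces the identity on `I` and on `H` is the translation by a derivation. -/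
theorem InducesPair.exists_mem_Z1 {E : Extension.{u, v, w} H I} (hE : E.HasCoupling χ) {γ : E.autI}
    (h : E.InducesPair γ.1 1) : ∃ l : χ.Z1, ∀ x, γ.1 x = x * E.j (l.1 (E.π x)) := by
  have hi : ∀ y, γ.1 (E.i y) = E.i y := h.2
  obtain ⟨l, hl⟩ := exists_center_translation (E := E) γ.1 (fun x y => by rw [map_mul, hi])
    (fun x y => by rw [map_mul, hi]) h.1
  refine ⟨⟨l, (mem_Z1_iff hE l).mpr ⟨fun x y => ?_, fun x y => ?_⟩⟩, hl⟩
  · rw [← hl, ← hl, ← hl, map_add]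
  · rw [← hl, ← hl, ← hl, map_mul]

end Extension

theorem wells_exact_sequence [IsTrivial I] (χ : Triple H I) (E : Extension.{u, v, w} H I)
    (hE : E.HasCoupling χ) :
    ∃ (ψ : Multiplicative χ.Z1 →* E.autI) (ρ : E.autI →* χ.stabilizer) (ω : χ.stabilizer → χ.H2),
      (∀ (l : χ.Z1) (x : E.Carrier),
        (ψ (Multiplicative.ofAdd l)).1 x = x * E.i (l.1 (E.π x))) ∧
      (∀ γ : E.autI, E.InducesPair γ.1 (ρ γ).1) ∧
      E.IsWellsMap hE ω ∧
      Function.Injective ψ ∧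
      ψ.range = ρ.ker ∧
      Set.range ρ = {c | ω c = 0} ∧
      ∀ c d, ω (c * d) = χ.actH2 d (ω c) + ω d := by
  obtain ⟨ψ, hψ⟩ := Extension.exists_derivationHom hE
  obtain ⟨ρ, hρ⟩ := Extension.exists_inducedHom hE
  obtain ⟨ω, hω⟩ := Extension.exists_isWellsMap hE
  refine ⟨ψ, ρ, ω, hψ, hρ, hω, fun l l' h => ?_, ?_, ?_, hω.map_mul⟩
  · refine Multiplicative.toAdd.injective (Subtype.ext (funext fun p => ?_))
    obtain ⟨x, rfl⟩ := E.π_surjective p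
    have e := hψ l.toAdd x
    have e' := hψ l'.toAdd x
    rw [ofAdd_toAdd] at e e'
    rw [h, e'] at e
    exact (E.j_injective (mul_left_cancel e)).symm
  · have hker : ∀ γ, γ ∈ ρ.ker ↔ E.InducesPair γ.1 1 := fun γ =>
      ⟨fun h => by simpa only [MonoidHom.mem_ker.mp h, OneMemClass.coe_one] using hρ γ,
        fun h => Subtype.ext ((hρ γ).unique h)⟩
    ext γ
    rw [hker]
    constructor
    · rintro ⟨l, rfl⟩
      refine ⟨fun x => ?_, fun y => ?_⟩
      · exact (congrArg E.π (hψ l.toAdd x)).trans (by rw [E.π_mul, E.π_j, mul_zero']; rfl)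
      · have h0 := hψ l.toAdd 0
        rw [aut_zero, zero_mul', E.π_zero] at h0
        exact (hψ l.toAdd _).trans (by rw [E.π_i, ← h0, mul_zero']; rfl)
    · intro h
      obtain ⟨l, hl⟩ := h.exists_mem_Z1 hE
      exact ⟨Multiplicative.ofAdd l, Subtype.ext (RingEquiv.ext fun x => (hψ l x).trans (hl x).symm)⟩
  · ext c
    rw [Set.mem_ofPred_eq, hω.eq_zero_iff, E.equivalent_pull_iff]
    constructor
    · rintro ⟨γ, rfl⟩
      exact ⟨γ, hρ γ⟩
    · rintro ⟨γ, h⟩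
      exact ⟨γ, Subtype.ext ((hρ γ).unique h)⟩

end SkewBrace

/-! ### A Wells map that is not a homomorphism -/

namespace SkewBrace

/-- The trivial skew brace on an additive group `A`. A type synonym keeps its multiplication `a ∘ b = a + b`
apart from a ring multiplication on `A`. -/
def TrivialBrace (A : Type*) : Type _ := A

namespace TrivialBrace

instance {A : Type*} [AddGroup A] : SkewBrace (TrivialBrace A) :=
  { (inferInstance : AddGroup A) with
    mul := fun a b : A => a + b
    one := (0 : A)
    inv := fun a : A => -a
    mul_assoc := fun a b c : A => add_assoc a b c
    one_mul := fun a : A => zero_add a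
    mul_one := fun a : A => add_zero a
    inv_mul_cancel := fun a : A => neg_add_cancel a
    mul_add_brace := fun a b c : A => by
      change a + (b + c) = a + b - a + (a + c)
      simp only [sub_eq_add_neg, add_assoc, neg_add_cancel_left] }

instance {A : Type*} [AddGroup A] : IsTrivial (TrivialBrace A) := ⟨fun _ _ => rfl⟩

end TrivialBrace

/-- The map `y ↦ 3y` from `ℤ/3` to `ℤ/9`. -/
def zmodThreeToNine (y : ZMod 3) : ZMod 9 := 3 * (y.val : ZMod 9)

/-- Reduction modulo `3` on `ℤ/9`. -/
def zmodNineToThree (x : ZMod 9) : ZMod 3 := (x.val : ZMod 3)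

theorem zmodThreeToNine_add : ∀ a b,
    zmodThreeToNine (a + b) = zmodThreeToNine a + zmodThreeToNine b := by decide

theorem zmodNineToThree_add : ∀ a b,
    zmodNineToThree (a + b) = zmodNineToThree a + zmodNineToThree b := by decide

theorem zmodThreeToNine_injective : ∀ a b, zmodThreeToNine a = zmodThreeToNine b → a = b := by
  decide

theorem zmodNineToThree_surjective : ∀ b, ∃ a, zmodNineToThree a = b := by decide

theorem zmodNineToThree_eq_zero_iff :
    ∀ x, zmodNineToThree x = 0 ↔ ∃ y, zmodThreeToNine y = x := by decide

/-- The extension `0 → ℤ/3 → ℤ/9 → ℤ/3 → 0` of trivial skew braces. -/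
def zmodNine : Extension.{0, 0, 0} (TrivialBrace (ZMod 3)) (TrivialBrace (ZMod 3)) where
  Carrier := TrivialBrace (ZMod 9)
  i := zmodThreeToNine
  π := zmodNineToThree
  i_add := zmodThreeToNine_add
  i_mul := zmodThreeToNine_add
  π_add := zmodNineToThree_add
  π_mul := zmodNineToThree_add
  i_injective := zmodThreeToNine_injective
  π_surjective := zmodNineToThree_surjective
  exact := zmodNineToThree_eq_zero_iff

/-- The triple whose maps are all the identity. -/
def idTriple (H I : Type*) [SkewBrace H] [SkewBrace I] : Triple H I where
  nu _ := AddEquiv.refl I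
  mu _ := AddEquiv.refl I
  sigma _ := MulEquiv.refl I

theorem zmodNine_hasCoupling : zmodNine.HasCoupling (idTriple _ _) := by
  refine ⟨fun h => ((ZMod.val (n := 3) h : ZMod 9) : ZMod 9), idTriple _ _, ⟨?_, rfl⟩, ?_,
    Triple.Approx.refl _⟩
  · change ∀ h : ZMod 3, zmodNineToThree (h.val : ZMod 9) = h
    decide
  · intro h y
    refine ⟨?_, ?_, ?_⟩
    · exact (neg_add_cancel_left (G := ZMod 9) _ _).symm
    · exact (neg_add_cancel_comm (G := ZMod 9) _ _).symm
    · exact (neg_add_cancel_comm (G := ZMod 9) _ _).symm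

/-- Negation on `ℤ/3`, as a skew brace automorphism. -/
def negAut : RingAut (TrivialBrace (ZMod 3)) :=
  { Equiv.neg (ZMod 3) with
    map_add' := neg_add (α := ZMod 3)
    map_mul' := neg_add (α := ZMod 3) }

theorem negAut_mul_self : negAut * negAut = 1 := RingEquiv.ext (neg_neg (G := ZMod 3))

theorem neg_mem_stabilizer :
    ((1, negAut) : RingAut (TrivialBrace (ZMod 3)) × RingAut (TrivialBrace (ZMod 3))) ∈
      (idTriple (TrivialBrace (ZMod 3)) (TrivialBrace (ZMod 3))).stabilizer := by
  have e : (idTriple (TrivialBrace (ZMod 3)) (TrivialBrace (ZMod 3))).pull (1, negAut) =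
      idTriple _ _ :=
    Triple.ext (funext fun _ => AddEquiv.ext negAut.symm_apply_apply)
      (funext fun _ => AddEquiv.ext negAut.symm_apply_apply)
      (funext fun _ => MulEquiv.ext negAut.symm_apply_apply)
  change Triple.Approx _ _
  rw [e]
  exact Triple.Approx.refl _

/-- An automorphism `γ` of `ℤ/9` over `ℤ/3` has `γ(3) = 3γ(1) = 3`, so it cannot restrict to `-1` on `3ℤ/9ℤ`. -/
theorem not_equivalent_pull_neg : ¬ zmodNine.Equivalent (zmodNine.pull (1, negAut)) := by
  rw [Extension.equivalent_pull_iff]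
  rintro ⟨γ, hπ, hi⟩
  have key : ∀ a : ZMod 9, zmodNineToThree a = zmodNineToThree 1 → a + a + a ≠ zmodThreeToNine (-1) := by
    decide
  let one : zmodNine.Carrier := (1 : ZMod 9)
  have h3 : γ.1 (one + one + one) = γ.1 one + γ.1 one + γ.1 one := by rw [map_add, map_add]
  exact key (γ.1 one) (hπ one) (h3.symm.trans (hi (1 : ZMod 3)))

theorem Triple.H2_add_self_add_self {H : Type*} [SkewBrace H]
    (χ : Triple H (TrivialBrace (ZMod 3))) (k : χ.H2) : k + k + k = 0 := by
  have h3 : ∀ a : AddSubgroup.center (TrivialBrace (ZMod 3)), a + a + a = 0 := fun a =>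
    Subtype.ext ((by decide : ∀ a : ZMod 3, a + a + a = 0) a.1)
  induction k using QuotientAddGroup.induction_on with
  | H z =>
    have : z + z + z = 0 := Subtype.ext (Prod.ext
      (funext fun p => funext fun q => h3 _) (funext fun p => funext fun q => h3 _))
    exact congrArg (QuotientAddGroup.mk' χ.B2) this

/-- For `c = (1, -1)` one has `c² = 1` while `H²` is killed by `3`: if the Wells map were a homomorphism, it
would vanish at `c`. -/
theorem exists_isWellsMap_not_hom :
    ∃ (H I : Type) (_ : SkewBrace H) (_ : SkewBrace I) (_ : IsTrivial I)
      (χ : Triple H I) (E : Extension.{0, 0, 0} H I)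
      (hE : E.HasCoupling χ) (ω : χ.stabilizer → χ.H2),
      E.IsWellsMap hE ω ∧ ¬ ∀ c d, ω (c * d) = ω c + ω d := by
  obtain ⟨ω, hω⟩ := Extension.exists_isWellsMap zmodNine_hasCoupling
  refine ⟨_, _, _, _, inferInstance, _, zmodNine, zmodNine_hasCoupling, ω, hω, fun hom => ?_⟩
  apply not_equivalent_pull_neg
  refine (hω.eq_zero_iff ⟨(1, negAut), neg_mem_stabilizer⟩).mp ?_
  generalize hc : (⟨(1, negAut), neg_mem_stabilizer⟩ : (idTriple _ _).stabilizer) = c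
  have hcc : c * c = 1 := by
    subst hc
    exact Subtype.ext (Prod.ext (mul_one 1) negAut_mul_self)
  have h1 := hom 1 1
  rw [mul_one, left_eq_add] at h1
  have h2 := hom c c
  rw [hcc, h1] at h2
  have h3 := Triple.H2_add_self_add_self _ (ω c)
  rwa [← h2, zero_add] at h3

end SkewBrace

theorem mainTheorem1 :
    (∀ (H : Type u) (I : Type v) [SkewBrace H] [SkewBrace I] [SkewBrace.IsTrivial I]
      (χ : SkewBrace.Triple H I) (E : SkewBrace.Extension.{u, v, w} H I) (hE : E.HasCoupling χ),
      ∃ (ψ : Multiplicative χ.Z1 →* E.autI) (ρ : E.autI →* χ.stabilizer)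
        (ω : χ.stabilizer → χ.H2),
        -- the three maps
        (∀ (l : χ.Z1) (x : E.Carrier),
          (ψ (Multiplicative.ofAdd l)).1 x = x * E.i (l.1 (E.π x))) ∧
        (∀ γ : E.autI, (∀ x, E.π (γ.1 x) = (ρ γ).1.1 (E.π x)) ∧
          ∀ y, γ.1 (E.i y) = E.i ((ρ γ).1.2 y)) ∧
        E.IsWellsMap hE ω ∧
        -- exactness
        Function.Injective ψ ∧
        ψ.range = ρ.ker ∧
        Set.range ρ = {c | ω c = 0} ∧
        -- the last map is a derivation
        ∀ c d, ω (c * d) = χ.actH2 d (ω c) + ω d) ∧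
    -- the last map is in general not a homomorphism
    (∃ (H I : Type) (_ : SkewBrace H) (_ : SkewBrace I) (_ : SkewBrace.IsTrivial I)
      (χ : SkewBrace.Triple H I) (E : SkewBrace.Extension.{0, 0, 0} H I)
      (hE : E.HasCoupling χ) (ω : χ.stabilizer → χ.H2),
      E.IsWellsMap hE ω ∧ ¬ ∀ c d, ω (c * d) = ω c + ω d) := by
  refine ⟨fun H I _ _ _ χ E hE => ?_, SkewBrace.exists_isWellsMap_not_hom⟩
  exact SkewBrace.wells_exact_sequence χ E hE
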